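/- Let $G=(V,D,B)$ be a finite mixed graph (directed edges $D$ without self-loops, bidirected edges $B$) that is acyclic (no directed cycles) and bow-free (no two nodes are joined by both a directed and a bidirected edge). Write $\mathrm{pa}(v)$ for the set of parents of $v$ and $\mathrm{htr}(v)$ for the set of nodes reachable from $v$ by a half-trek, i.e. a directed path whose first edge may instead be bidirected. Let $R=\mathbb{R}[\sigma_{vw} : v,w\in V]$ with $\sigma_{vw}=\sigma_{wv}$. For an ideal $J\subseteq R$ let $V(J)$ be the set of symmetric real matrices $\Sigma$ at which all $f\in J$ vanish. Let $\mathcal M(G)$ be the set of matrices $(I-\Lambda)^{-T}\Omega(I-\Lambda)^{-1}$ with $\Lambda_{vw}=0$ unless $v\to w\in D$, with $I-\Lambda$ invertible, and with $\Omega$ positive definite such that $\Omega_{vw}=0$ whenever $v\ne w$ and $v\leftrightarrow w\notin B$. Let $\overline{\mathcal M(G)}=V(I_G)$, where $I_G$ is the ideal of all polynomials that vanish on $\mathcal M(G)$. Graphical constraints. A graphical constraint is a bipartite graph whose nodes are labelled with subsets of $V$. It represents, up to sign, the determinant of the square matrix with rows indexed by the pairs $(a,v)$ ($a$ a node of the first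 part, $v$ in the label of $a$), columns indexed by the pairs $(b,w)$ ($b$ a node of the second part, $w$ in the label of $b$), and entry $\sigma_{vw}$ if $a,b$ are adjacent and $0$ otherwise. For every pair of distinct nodes $v,w\in V$ with $v\leftrightarrow w\notin B$, $v\notin\mathrm{pa}(w)$ and $w\notin\mathrm{pa}(v)$, construct a graphical constraint as follows. Start with two adjacent nodes labelled $\{v\}$ and $\{w\}$ and expand both, where expanding a node $t$ with label $\{u\}$ means: replace its label by $\{u\}\cup\mathrm{pa}(u)$; for each $y\in Y_u:=\mathrm{pa}(u)$ attach to $t$ a new node $t_y$ with label $\{y\}$; and for each such $y$ with $y\in\mathrm{htr}(u)$ expand $t_y$. Finally, wherever several leaves are attached to the same node, merge them into a single leaf labelled with the union of their labels. Let $J_G\subseteq R$ be the ideal generated by the polynomials represented by all these graphical constraints. A polynomial $f\in R$ is $V$-homogeneous if for each $v\in V$ the number of occurrences of $v$ in the indices of the $\sigma$'s (counting $\sigma_{vv}$ twice) is the same for all terms of $f$. Then $J_G$ is $I$-primary, in the following sense. In every minimal primary decomposition of $J_G$ there is exactly one component $Q$ with $V(Q)=\overline{\mathcal M(G)}$. Every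 other (spurious) component contains a $V$-homogeneous polynomial in which some monomial $\prod_{v\in V}\sigma_{vv}^{k_v}$ occurs with nonzero coefficient. Consequently, no diagonal positive definite matrix lies in the variety of a spurious component. -/

import Mathlib

/-- A mixed graph: directed edges `u → v` (`G.dir u v`) without self-loops, and bidirected edges
`u ↔ v` (`G.bi.Adj u v`). -/
structure MixedGraph (V : Type*) where
  dir : V → V → Prop
  dir_irrefl : ∀ v, ¬ dir v v
  bi : SimpleGraph V

namespace MixedGraph

variable {V : Type*}

/-- The parents of `v`. -/
def pa (G : MixedGraph V) (v : V) : Set V := {u | G.dir u v}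

/-- There are no directed cycles. -/
def IsAcyclic (G : MixedGraph V) : Prop := ∀ v, ¬ Relation.TransGen G.dir v v

/-- No two nodes are joined both by a directed and by a bidirected edge. -/
def IsBowFree (G : MixedGraph V) : Prop := ∀ u v, G.dir u v → ¬ G.bi.Adj u v

/-- The nodes reachable from `v` by a half-trek: a directed path, except that the first edge may
instead be bidirected. -/
def htr (G : MixedGraph V) (v : V) : Set V :=
  {y | Relation.ReflTransGen G.dir v y ∨ ∃ u, G.bi.Adj v u ∧ Relation.ReflTransGen G.dir u y}

end MixedGraph

/-- The polynomial ring in the entries `σ_{vw} = σ_{wv}` of a symmetric matrix. -/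
abbrev CovPoly (V : Type*) : Type _ := MvPolynomial (Sym2 V) ℝ

/-- Symmetric real matrices. -/
abbrev SymMatrix (V : Type*) : Type _ := {S : Matrix V V ℝ // S.IsSymm}

/-- The entry of a symmetric matrix at an unordered pair of indices. -/
def SymMatrix.entry {V : Type*} (S : SymMatrix V) : Sym2 V → ℝ :=
  Sym2.lift ⟨fun v w => S.1 v w, fun v w => (S.2.apply v w).symm⟩

namespace CovPoly

variable {V : Type*}

/-- The value `f(Σ)`. -/
noncomputable def evalAt (S : SymMatrix V) (f : CovPoly V) : ℝ := MvPolynomial.eval S.entry f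

/-- The variety `V(I)` of symmetric real matrices at which all elements of `I` vanish. -/
def variety (I : Ideal (CovPoly V)) : Set (SymMatrix V) := {S | ∀ f ∈ I, evalAt S f = 0}

/-- The ideal of all polynomials that vanish on a set of symmetric matrices. -/
noncomputable def vanishing (A : Set (SymMatrix V)) : Ideal (CovPoly V) :=
  ⨅ S ∈ A, RingHom.ker (MvPolynomial.eval S.entry)

/-- For each `v`, the number of occurrences of `v` in the indices of the `σ`'s (with `σ_{vv}`
counting twice) is the same for all terms of `f`. -/
def IsVHomogeneous [DecidableEq V] (f : CovPoly V) : Prop :=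
  ∃ d : V → ℕ, MvPolynomial.IsWeightedHomogeneous
    (fun (e : Sym2 V) (v : V) => e.toMultiset.count v) f d

/-- Some monomial `∏ v, σ_{vv} ^ k v` occurs in `f` with a nonzero coefficient. -/
def HasDiagonalMonomial (f : CovPoly V) : Prop :=
  ∃ m : Sym2 V →₀ ℕ, f.coeff m ≠ 0 ∧ ∀ e ∈ m.support, e.IsDiag

end CovPoly

/-- A graphical constraint: an undirected graph with a chosen bipartition (the part `true` gives
the rows, the part `false` the columns), the nodes of which are labelled with sets of variables. -/
structure GraphicalConstraint (V : Type*) where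
  Node : Type*
  graph : SimpleGraph Node
  side : graph.Coloring Bool
  label : Node → Set V

namespace GraphicalConstraint

variable {V : Type*} (C : GraphicalConstraint V)

/-- The pairs `(a, v)` with `a` in the given part and `v` in the label of `a`. -/
def Index (part : Bool) : Type _ := {p : C.Node × V // C.side p.1 = part ∧ p.2 ∈ C.label p.1}

open Classical in
/-- The matrix of a graphical constraint. -/
noncomputable def matrix : Matrix (C.Index true) (C.Index false) (CovPoly V) :=
  fun p q => if C.graph.Adj p.1.1 q.1.1 then MvPolynomial.X s(p.1.2, q.1.2) else 0

/-- `f` is the determinant of the (finite and square) matrix of `C` for some ordering of its rows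
and columns. This determines `f` up to sign. -/
def Represents (f : CovPoly V) : Prop :=
  ∃ (n : ℕ) (r : Fin n ≃ C.Index true) (c : Fin n ≃ C.Index false),
    f = (C.matrix.submatrix r c).det

/-- A leaf: a node with exactly one neighbour. -/
def IsLeaf (t : C.Node) : Prop := ∃! u, C.graph.Adj t u

/-- Two nodes are identified when they are equal, or are leaves attached to the same node. -/
def leafSetoid : Setoid C.Node where
  r s t := s = t ∨ (C.IsLeaf s ∧ C.IsLeaf t ∧ ∃ u, C.graph.Adj s u ∧ C.graph.Adj t u)
  iseqv := by
    refine ⟨fun s => Or.inl rfl, ?_, ?_⟩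
    · rintro s t (h | ⟨hs, ht, u, hsu, htu⟩)
      · exact Or.inl h.symm
      · exact Or.inr ⟨ht, hs, u, htu, hsu⟩
    · rintro s t k (rfl | ⟨hs, ht, u, hsu, htu⟩) h2
      · exact h2
      · rcases h2 with rfl | ⟨ht', hk, u', htu', hku'⟩
        · exact Or.inr ⟨hs, ht, u, hsu, htu⟩
        · have : u = u' := ht.unique htu htu'
          subst this
          exact Or.inr ⟨hs, hk, u, hsu, hku'⟩

theorem side_eq_of_leafSetoid {s t : C.Node} (h : C.leafSetoid s t) : C.side s = C.side t := by
  rcases h with rfl | ⟨_, _, u, hsu, htu⟩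
  · rfl
  · have h1 := C.side.valid hsu
    have h2 := C.side.valid htu
    revert h1 h2
    cases C.side s <;> cases C.side t <;> cases C.side u <;> simp

/-- Wherever two or more leaf nodes are attached to the same node, merge them into a single leaf
node labelled with the union of their labels. -/
def mergeLeaves : GraphicalConstraint V where
  Node := Quotient C.leafSetoid
  graph :=
    { Adj := fun q q' => ∃ s t : C.Node,
        Quotient.mk C.leafSetoid s = q ∧ Quotient.mk C.leafSetoid t = q' ∧ C.graph.Adj s t
      symm := ⟨by
        rintro q q' ⟨s, t, hs, ht, h⟩
        exact ⟨t, s, ht, hs, h.symm⟩⟩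
      loopless := ⟨by
        rintro q ⟨s, t, hs, ht, h⟩
        exact C.side.valid h (C.side_eq_of_leafSetoid (Quotient.exact (hs.trans ht.symm)))⟩ }
  side := SimpleGraph.Coloring.mk
    (Quotient.lift (fun s => C.side s) (fun _ _ h => C.side_eq_of_leafSetoid h))
    (by
      rintro q q' ⟨s, t, rfl, rfl, h⟩
      exact C.side.valid h)
  label q := {x | ∃ t : C.Node, Quotient.mk C.leafSetoid t = q ∧ x ∈ C.label t}

end GraphicalConstraint

namespace MixedGraph

variable {V : Type*}

/-- The nodes that the construction creates are identified with paths: the seed with original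
label `{v}` is `[v]`, and the node `t_y` created when the node `t = u :: l` (with original label
`{u}`) is expanded is `y :: u :: l`. This says which of these nodes get expanded: the seed does, and
`t_y` does if and only if `y ∈ htr u`. -/
def IsExpanded (G : MixedGraph V) : List V → Prop
  | [] => False
  | [_] => True
  | y :: u :: _ => y ∈ G.htr u

/-- The nodes descending from the seed `v`: expanding a node with original label `{u}` creates a
node with original label `{y}` for each `y ∈ Y u`. -/
inductive IsTreeNode (G : MixedGraph V) (Y : V → Set V) (v : V) : List V → Prop
  | seed : IsTreeNode G Y v [v]
  | child {y u : V} {l : List V} : IsTreeNode G Y v (u :: l) → G.IsExpanded (u :: l) → y ∈ Y u →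
      IsTreeNode G Y v (y :: u :: l)

/-- The final label of a node with original label `{u}`: it is `{u} ∪ pa u` if the node has been
expanded, and `{u}` otherwise. -/
def nodeLabel (G : MixedGraph V) : List V → Set V
  | [] => ∅
  | u :: l => {u} ∪ {x | x ∈ G.pa u ∧ G.IsExpanded (u :: l)}

/-- The tree obtained from two adjacent seed nodes, labelled `{v}` (tagged `true`) and `{w}`
(tagged `false`), by expanding both, before any leaves are merged. The two parts of the tree alternate
with the distance to the seeds. -/
def expansionTree (G : MixedGraph V) (Y : V → Set V) (v w : V) : GraphicalConstraint V where
  Node := {p : Bool × List V // G.IsTreeNode Y (if p.1 then v else w) p.2}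
  graph :=
    { Adj := fun p q =>
        (p.1.1 ≠ q.1.1 ∧ p.1.2.length = 1 ∧ q.1.2.length = 1) ∨
        (p.1.1 = q.1.1 ∧ ((∃ y, q.1.2 = y :: p.1.2) ∨ (∃ y, p.1.2 = y :: q.1.2)))
      symm := ⟨by
        rintro p q (⟨h1, h2, h3⟩ | ⟨h1, h2⟩)
        · exact Or.inl ⟨h1.symm, h3, h2⟩
        · exact Or.inr ⟨h1.symm, h2.symm⟩⟩
      loopless := ⟨by
        rintro p (⟨h1, _⟩ | ⟨_, ⟨y, h⟩ | ⟨y, h⟩⟩)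
        · exact h1 rfl
        · simpa using congrArg List.length h
        · simpa using congrArg List.length h⟩ }
  side := SimpleGraph.Coloring.mk (fun p => xor p.1.1 (decide (p.1.2.length % 2 = 0)))
    (by
      rintro p q (⟨h1, h2, h3⟩ | ⟨h1, ⟨y, h⟩ | ⟨y, h⟩⟩)
      · simpa [h2, h3] using h1
      · rw [h1, h, List.length_cons]
        rcases Nat.mod_two_eq_zero_or_one p.1.2.length with h' | h' <;>
          simp [h', Nat.add_mod]
      · rw [h1, h, List.length_cons]
        rcases Nat.mod_two_eq_zero_or_one q.1.2.length with h' | h' <;>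
          simp [h', Nat.add_mod])
  label p := G.nodeLabel p.1.2

/-- The half-trek based construction: the graphical constraint that it outputs for the family `Y`
and the pair `{v, w}`. -/
def htcConstraint (G : MixedGraph V) (Y : V → Set V) (v w : V) : GraphicalConstraint V :=
  (G.expansionTree Y v w).mergeLeaves

/-- The ideal generated by the polynomials of the graphical constraints for all pairs `{v, w}` of
distinct nodes with `v ↔ w ∉ B`, `v ∉ Y w` and `w ∉ Y v`. -/
noncomputable def htcIdeal (G : MixedGraph V) (Y : V → Set V) : Ideal (CovPoly V) :=
  Ideal.span {f | ∃ v w : V, v ≠ w ∧ ¬ G.bi.Adj v w ∧ v ∉ Y w ∧ w ∉ Y v ∧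
    (G.htcConstraint Y v w).Represents f}

variable [Fintype V] [DecidableEq V]

/-- The model `M(G)`: the covariance matrices `(I - Λ)⁻ᵀ Ω (I - Λ)⁻¹` of the linear structural
equation models with mixed graph `G`. -/
def model (G : MixedGraph V) : Set (SymMatrix V) :=
  {S | ∃ L W : Matrix V V ℝ,
    (∀ v w, ¬ G.dir v w → L v w = 0) ∧ IsUnit (1 - L) ∧
    W.PosDef ∧ (∀ v w, v ≠ w → ¬ G.bi.Adj v w → W v w = 0) ∧
    S.1 = ((1 - L)⁻¹).transpose * W * (1 - L)⁻¹}

/-- The algebraic model: the zero set of the ideal of all polynomials vanishing on the model. -/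
def algebraicModel (G : MixedGraph V) : Set (SymMatrix V) :=
  CovPoly.variety (CovPoly.vanishing G.model)

/-- A primary component is spurious if its variety is not the algebraic model. -/
def IsSpurious (G : MixedGraph V) (Q : Ideal (CovPoly V)) : Prop :=
  CovPoly.variety Q ≠ G.algebraicModel

/-- `I` is `I`-primary (with respect to `G`): in every minimal primary decomposition of `I`, every
spurious component contains a `V`-homogeneous polynomial in which a monomial `∏ v, σ_{vv} ^ k v`
occurs. -/
def IsIPrimary (G : MixedGraph V) (I : Ideal (CovPoly V)) : Prop :=
  ∀ t : Finset (Ideal (CovPoly V)), Submodule.IsMinimalPrimaryDecomposition I t →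
    ∀ Q ∈ t, G.IsSpurious Q →
      ∃ f ∈ Q, CovPoly.IsVHomogeneous f ∧ CovPoly.HasDiagonalMonomial f

end MixedGraph

/-! Let U be the multiplicative set of `V`-homogeneous polynomials that do not vanish at the
identity matrix (`unitSubmonoid`). The point is that J_G and I_G become equal once U is inverted.

Over the fraction ring `CovFrac`, the half-trek equations for a column of Λ are linear, with
coefficients built from the columns of the parents. At Σ = 1 the system has matrix 1 and right-hand
side 0, so Cramer's rule gives a `V`-homogeneous solution Λ that vanishes at the identity
(`exists_isSolution`). Row and column operations built from Λ make the matrix of a graphical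
constraint block triangular, and its determinant is, up to sign, a cofactor times the entry of (1 -
Λ)ᵀ Σ (1 - Λ) at (v, w) (`map_of_represents_htcConstraint`). The cofactor is `V`-homogeneous with
value 1 at the identity, hence a unit (`isUnit_cofactor`). So these entries vanish modulo J_G;
together with the half-trek equations, this gives every zero required of Ω. The quotient map
therefore factors through the parametrization, whose kernel is I_G, and each f in I_G has some s in
U with s f in J_G (`exists_mul_mem_htcIdeal`). At a point of the model the same factorization shows
J_G ⊆ I_G.

Finally, I_G is prime, and it misses U because the identity lies in the model. A primary component
that misses U contains I_G, and some component is contained in I_G, hence equal to it. By minimality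
all others meet U. An element of U has a diagonal monomial and, by scaling, is nonzero at every
positive definite diagonal matrix. -/

/-- The identity matrix as a symmetric matrix. -/
def SymMatrix.identity (V : Type*) [DecidableEq V] : SymMatrix V := ⟨1, Matrix.isSymm_one⟩

/-! ### `V`-homogeneous polynomials at diagonal matrices -/

namespace CovPoly

variable {V : Type*} [DecidableEq V]

/-- The multidegree of the variable `σ_{vw}`: the indicator vector of the multiset `{v, w}`. -/
def vWeight (e : Sym2 V) (v : V) : ℕ := e.toMultiset.count v

theorem vWeight_mk (x y : V) : vWeight s(x, y) = Pi.single x 1 + Pi.single y 1 := by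
  funext v
  have : s(x, y).toMultiset = {x, y} := rfl
  simp only [vWeight, this, Multiset.insert_eq_cons, Multiset.count_cons,
    Multiset.count_singleton, Pi.add_apply, Pi.single_apply]
  ring

/-- The multidegree with integer values. -/
def intWeight (e : Sym2 V) (v : V) : ℤ := vWeight e v

theorem intWeight_mk (x y : V) : intWeight s(x, y) = Pi.single x 1 + Pi.single y 1 := by
  funext v
  simp [intWeight, vWeight_mk, Pi.single_apply]

theorem weight_intWeight (m : Sym2 V →₀ ℕ) (v : V) :
    Finsupp.weight intWeight m v = Finsupp.weight vWeight m v := by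
  simp [Finsupp.weight_apply, Finsupp.sum, Finset.sum_apply, intWeight]

/-- Integer degrees are needed because an edge coefficient λ_{xy} has degree e_y - e_x. Monomials
have nonnegative degrees, so truncating `d` loses nothing for polynomials. -/
theorem isVHomogeneous_of_intWeight {f : CovPoly V} {d : V → ℤ}
    (hf : MvPolynomial.IsWeightedHomogeneous intWeight f d) : IsVHomogeneous f := by
  refine ⟨fun v => (d v).toNat, fun m hm => funext fun v => ?_⟩
  have h := congrFun (hf hm) v
  rw [weight_intWeight] at h
  rw [← h, Int.toNat_natCast]
  rfl

/-- Evaluation at the identity matrix. -/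
noncomputable def evalOne : CovPoly V →+* ℝ := MvPolynomial.eval (SymMatrix.identity V).entry

theorem evalOne_X (x y : V) :
    evalOne (MvPolynomial.X s(x, y) : CovPoly V) = (1 : Matrix V V ℝ) x y := by
  simp [evalOne, SymMatrix.entry, SymMatrix.identity]

/-- The `V`-homogeneous polynomials that do not vanish at the identity matrix. -/
noncomputable def unitSubmonoid (V : Type*) [DecidableEq V] : Submonoid (CovPoly V) where
  carrier := {f | (∃ d, MvPolynomial.IsWeightedHomogeneous intWeight f d) ∧ evalOne f ≠ 0}
  one_mem' := ⟨⟨0, MvPolynomial.isWeightedHomogeneous_one _ _⟩, by simp⟩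
  mul_mem' := by
    rintro f g ⟨⟨d, hf⟩, hf'⟩ ⟨⟨e, hg⟩, hg'⟩
    exact ⟨⟨d + e, hf.mul hg⟩, by simp [hf', hg']⟩

theorem entry_smul_diag {D : SymMatrix V} (hD : D.1.IsDiag) {t : V → ℝ}
    (ht : ∀ v, D.1 v v = t v ^ 2) (x y : V) :
    D.entry s(x, y) = (SymMatrix.identity V).entry s(x, y) * (t x * t y) := by
  by_cases h : x = y
  · subst h
    simp [SymMatrix.entry, SymMatrix.identity, ht, sq]
  · have := hD h
    simp_all [SymMatrix.entry, SymMatrix.identity]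

theorem prod_vWeight [Fintype V] (t : V → ℝ) (x y : V) :
    ∏ v, t v ^ vWeight s(x, y) v = t x * t y := by
  simp only [vWeight_mk, Pi.add_apply, pow_add, Finset.prod_mul_distrib, Pi.single_apply, pow_ite,
    pow_one, pow_zero, Finset.prod_ite_eq', Finset.mem_univ, if_true]

/-- The value of a `V`-homogeneous polynomial at a diagonal matrix is a multiple of its value at
the identity matrix. -/
theorem evalAt_diag [Fintype V] {f : CovPoly V} {d : V → ℕ}
    (hf : MvPolynomial.IsWeightedHomogeneous vWeight f d) {D : SymMatrix V} (hD : D.1.IsDiag)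
    {t : V → ℝ} (ht : ∀ v, D.1 v v = t v ^ 2) :
    evalAt D f = (∏ v, t v ^ d v) * evalOne f := by
  -- With T = diag(t), D = T · 1 · T; each index v in a monomial therefore contributes a factor t_v.
  have key : ∀ e : Sym2 V, D.entry e =
      (SymMatrix.identity V).entry e * ∏ v, t v ^ vWeight e v := by
    intro e
    induction e using Sym2.ind with
    | _ x y => rw [prod_vWeight, entry_smul_diag hD ht]
  rw [evalAt, evalOne, MvPolynomial.eval_eq, MvPolynomial.eval_eq, Finset.mul_sum]
  refine Finset.sum_congr rfl fun m hm => ?_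
  have hd := hf (MvPolynomial.mem_support_iff.mp hm)
  have : ∏ i ∈ m.support, D.entry i ^ m i =
      (∏ i ∈ m.support, (SymMatrix.identity V).entry i ^ m i) * ∏ v, t v ^ d v := by
    simp_rw [key, mul_pow, Finset.prod_mul_distrib]
    congr 1
    simp_rw [← Finset.prod_pow]
    rw [Finset.prod_comm]
    refine Finset.prod_congr rfl fun v _ => ?_
    simp_rw [← pow_mul]
    rw [Finset.prod_pow_eq_pow_sum, ← hd, Finsupp.weight_apply, Finsupp.sum, Finset.sum_apply]
    simp [mul_comm]
  rw [this]
  ring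

theorem evalAt_ne_zero_of_mem_unitSubmonoid [Fintype V] {f : CovPoly V}
    (hf : f ∈ unitSubmonoid V) {D : SymMatrix V} (hpos : D.1.PosDef) (hD : D.1.IsDiag) :
    evalAt D f ≠ 0 := by
  obtain ⟨hd, h1⟩ := hf
  obtain ⟨d, hd⟩ := isVHomogeneous_of_intWeight hd.choose_spec
  have hp : ∀ v, 0 < D.1 v v := fun v => hpos.diag_pos
  rw [evalAt_diag hd hD (t := fun v => Real.sqrt (D.1 v v))
    fun v => (Real.sq_sqrt (hp v).le).symm]
  refine mul_ne_zero (Finset.prod_ne_zero_iff.mpr fun v _ => ?_) h1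
  exact pow_ne_zero _ (Real.sqrt_pos.mpr (hp v)).ne'

/-- Every monomial with an off-diagonal variable is zero at the identity, so a nonzero value must
come from a diagonal monomial. -/
theorem hasDiagonalMonomial_of_evalOne_ne_zero {f : CovPoly V} (hf : evalOne f ≠ 0) :
    HasDiagonalMonomial f := by
  rw [evalOne, MvPolynomial.eval_eq] at hf
  obtain ⟨m, _, hm⟩ := Finset.exists_ne_zero_of_sum_ne_zero hf
  refine ⟨m, left_ne_zero_of_mul hm, fun e he => ?_⟩
  have := Finset.prod_ne_zero_iff.mp (right_ne_zero_of_mul hm) e he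
  induction e using Sym2.ind with
  | _ x y =>
    by_contra hxy
    rw [Sym2.mk_isDiag_iff] at hxy
    have he' : m s(x, y) ≠ 0 := Finsupp.mem_support_iff.mp he
    simp [SymMatrix.entry, SymMatrix.identity, Matrix.one_apply_ne hxy, he'] at this

end CovPoly

/-! ### Homogeneous fractions with denominators invertible at the identity -/

/-- The ring of fractions of `CovPoly V` whose denominators are `V`-homogeneous and do not vanish
at the identity matrix. -/
def CovFrac (V : Type*) [DecidableEq V] : Type _ := Localization (CovPoly.unitSubmonoid V)

noncomputable instance (V : Type*) [DecidableEq V] : CommRing (CovFrac V) :=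
  inferInstanceAs (CommRing (Localization (CovPoly.unitSubmonoid V)))

noncomputable instance (V : Type*) [DecidableEq V] : Algebra (CovPoly V) (CovFrac V) :=
  inferInstanceAs (Algebra (CovPoly V) (Localization (CovPoly.unitSubmonoid V)))

instance (V : Type*) [DecidableEq V] : IsLocalization (CovPoly.unitSubmonoid V) (CovFrac V) :=
  inferInstanceAs (IsLocalization _ (Localization (CovPoly.unitSubmonoid V)))

namespace CovFrac

open CovPoly

variable {V : Type*} [DecidableEq V]

/-- Evaluation at the identity matrix. -/
noncomputable def evalOne : CovFrac V →+* ℝ :=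
  IsLocalization.lift (M := unitSubmonoid V) (g := CovPoly.evalOne)
    fun s => (isUnit_iff_ne_zero.mpr s.2.2)

theorem evalOne_algebraMap (f : CovPoly V) :
    evalOne (algebraMap (CovPoly V) (CovFrac V) f) = CovPoly.evalOne f :=
  IsLocalization.lift_eq _ _

theorem isUnit_algebraMap {s : CovPoly V} (hs : s ∈ unitSubmonoid V) :
    IsUnit (algebraMap (CovPoly V) (CovFrac V) s) :=
  IsLocalization.map_units (CovFrac V) (⟨s, hs⟩ : unitSubmonoid V)

/-- The fraction `x` is `V`-homogeneous of multidegree `δ`. -/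
def IsHomogeneous (δ : V → ℤ) (x : CovFrac V) : Prop :=
  ∃ (p s : CovPoly V) (b : V → ℤ), MvPolynomial.IsWeightedHomogeneous intWeight p (b + δ) ∧
    MvPolynomial.IsWeightedHomogeneous intWeight s b ∧ s ∈ unitSubmonoid V ∧
    x * algebraMap _ _ s = algebraMap _ _ p

variable {δ ε : V → ℤ} {x y : CovFrac V}

theorem IsHomogeneous.zero (δ : V → ℤ) : IsHomogeneous δ (0 : CovFrac V) :=
  ⟨0, 1, 0, MvPolynomial.isWeightedHomogeneous_zero _ _ _,
    MvPolynomial.isWeightedHomogeneous_one _ _, one_mem _, by simp⟩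

theorem IsHomogeneous.one : IsHomogeneous 0 (1 : CovFrac V) :=
  ⟨1, 1, 0, MvPolynomial.isWeightedHomogeneous_one _ _,
    MvPolynomial.isWeightedHomogeneous_one _ _, one_mem _, by simp⟩

theorem IsHomogeneous.X (v w : V) : IsHomogeneous (Pi.single v 1 + Pi.single w 1)
    (algebraMap (CovPoly V) (CovFrac V) (MvPolynomial.X s(v, w))) := by
  refine ⟨MvPolynomial.X s(v, w), 1, 0, ?_, MvPolynomial.isWeightedHomogeneous_one _ _,
    one_mem _, by simp⟩
  rw [zero_add, ← intWeight_mk]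
  exact MvPolynomial.isWeightedHomogeneous_X _ _ _

theorem IsHomogeneous.neg (hx : IsHomogeneous δ x) : IsHomogeneous δ (-x) := by
  obtain ⟨p, s, b, hp, hs, hs', h⟩ := hx
  exact ⟨-p, s, b, hp.neg, hs, hs', by rw [neg_mul, h, map_neg]⟩

theorem IsHomogeneous.mul (hx : IsHomogeneous δ x) (hy : IsHomogeneous ε y) :
    IsHomogeneous (δ + ε) (x * y) := by
  obtain ⟨p, s, b, hp, hs, hs', h⟩ := hx
  obtain ⟨q, t, c, hq, ht, ht', h'⟩ := hy
  refine ⟨p * q, s * t, b + c, ?_, hs.mul ht, mul_mem hs' ht', ?_⟩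
  · rw [add_add_add_comm]
    exact hp.mul hq
  · rw [map_mul, map_mul, ← h, ← h']
    ring

theorem IsHomogeneous.add (hx : IsHomogeneous δ x) (hy : IsHomogeneous δ y) :
    IsHomogeneous δ (x + y) := by
  obtain ⟨p, s, b, hp, hs, hs', h⟩ := hx
  obtain ⟨q, t, c, hq, ht, ht', h'⟩ := hy
  refine ⟨p * t + s * q, s * t, b + c, ?_, hs.mul ht, mul_mem hs' ht', ?_⟩
  · refine .add ?_ ?_
    · rw [add_right_comm]
      exact hp.mul ht
    · rw [add_assoc]
      exact hs.mul hq
  · simp only [map_add, map_mul, ← h, ← h']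
    ring

theorem IsHomogeneous.sub (hx : IsHomogeneous δ x) (hy : IsHomogeneous δ y) :
    IsHomogeneous δ (x - y) := by
  rw [sub_eq_add_neg]
  exact hx.add hy.neg

theorem IsHomogeneous.sum {ι : Type*} (s : Finset ι) {f : ι → CovFrac V}
    (hf : ∀ i ∈ s, IsHomogeneous δ (f i)) : IsHomogeneous δ (∑ i ∈ s, f i) :=
  Finset.sum_induction f (IsHomogeneous δ) (fun _ _ => .add) (.zero δ) hf

theorem IsHomogeneous.prod {ι : Type*} (s : Finset ι) {f : ι → CovFrac V} {d : ι → V → ℤ}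
    (hf : ∀ i ∈ s, IsHomogeneous (d i) (f i)) : IsHomogeneous (∑ i ∈ s, d i) (∏ i ∈ s, f i) := by
  classical
  induction s using Finset.induction_on with
  | empty => simpa using IsHomogeneous.one
  | insert a s ha ih =>
    rw [Finset.sum_insert ha, Finset.prod_insert ha]
    exact (hf a (Finset.mem_insert_self a s)).mul
      (ih fun i hi => hf i (Finset.mem_insert_of_mem hi))

/-- Each Leibniz term uses every row and every column once, so all terms have the same degree. -/
theorem IsHomogeneous.det {ι : Type*} [Fintype ι] [DecidableEq ι]
    {M : Matrix ι ι (CovFrac V)} (a b : ι → V → ℤ) (hM : ∀ i j, IsHomogeneous (a i + b j) (M i j)) :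
    IsHomogeneous (∑ i, a i + ∑ i, b i) M.det := by
  rw [Matrix.det_apply]
  refine .sum _ fun σ _ => ?_
  have h : IsHomogeneous (∑ i, a i + ∑ i, b i) (∏ i, M (σ i) i) := by
    have := IsHomogeneous.prod Finset.univ (fun i _ => hM (σ i) i)
    rwa [Finset.sum_add_distrib, Equiv.sum_comp σ a] at this
  rcases Int.units_eq_one_or (Equiv.Perm.sign σ) with h' | h' <;> rw [h']
  · simpa using h
  · simpa using h.neg

/-- A `V`-homogeneous fraction that does not vanish at the identity is a unit, and its inverse is
`V`-homogeneous. -/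
theorem IsHomogeneous.exists_inv (hx : IsHomogeneous δ x) (h1 : evalOne x ≠ 0) :
    ∃ y, x * y = 1 ∧ IsHomogeneous (-δ) y := by
  obtain ⟨p, s, b, hp, hs, hs', h⟩ := hx
  -- The numerator is homogeneous and nonzero at the identity, so it is itself an admissible
  -- denominator.
  have hp' : p ∈ unitSubmonoid V := by
    refine ⟨⟨_, hp⟩, ?_⟩
    rw [← evalOne_algebraMap, ← h, map_mul, evalOne_algebraMap]
    exact mul_ne_zero h1 hs'.2
  obtain ⟨z, hz⟩ := (isUnit_algebraMap hp').exists_right_inv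
  refine ⟨algebraMap _ _ s * z, by rw [← mul_assoc, h, hz], s, p, b + δ, ?_, hp, hp', ?_⟩
  · rwa [add_neg_cancel_right]
  · rw [mul_assoc, mul_comm z, hz, mul_one]

theorem IsHomogeneous.isUnit (hx : IsHomogeneous δ x) (h1 : evalOne x ≠ 0) : IsUnit x :=
  (hx.exists_inv h1).elim fun _ h => .of_mul_eq_one _ h.1

end CovFrac

/-! ### Merging leaves does not change the determinant -/

namespace GraphicalConstraint

variable {V : Type*} (C : GraphicalConstraint V)

/-- Merged leaves share their only neighbour, so adjacency does not depend on the representatives.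
-/
theorem mergeLeaves_adj {s t : C.Node} :
    C.mergeLeaves.graph.Adj (Quotient.mk C.leafSetoid s) (Quotient.mk C.leafSetoid t) ↔
      C.graph.Adj s t := by
  refine ⟨?_, fun h => ⟨s, t, rfl, rfl, h⟩⟩
  rintro ⟨s', t', hs, ht, h⟩
  rcases Quotient.exact hs with rfl | ⟨hs', hs, u, hu', hu⟩
  · rcases Quotient.exact ht with rfl | ⟨ht', ht, x, hx', hx⟩
    · exact h
    · obtain rfl := ht'.unique h.symm hx'
      exact hx.symm
  · obtain rfl := hs'.unique h hu'
    rcases Quotient.exact ht with rfl | ⟨ht', ht, x, hx', hx⟩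
    · exact hu
    · obtain rfl := ht'.unique h.symm hx'
      obtain rfl := ht'.unique hu.symm h.symm
      exact hx.symm

/-- The index `(t, x)` of the merged constraint that corresponds to an index `(t, x)`. -/
def mergeIndex (part : Bool) (i : C.Index part) : C.mergeLeaves.Index part :=
  ⟨(Quotient.mk C.leafSetoid i.1.1, i.1.2), i.2.1, i.1.1, rfl, i.2.2⟩

/-- A union of labels keeps track of all indices exactly when the merged labels are disjoint. -/
theorem mergeIndex_bijective
    (h : ∀ s t, C.leafSetoid s t → s ≠ t → Disjoint (C.label s) (C.label t)) (part : Bool) :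
    Function.Bijective (C.mergeIndex part) := by
  constructor
  · rintro ⟨⟨s, x⟩, hs, hx⟩ ⟨⟨t, y⟩, ht, hy⟩ hst
    have hst' := congrArg Subtype.val hst
    obtain ⟨h1, rfl : x = y⟩ := Prod.mk.inj hst'
    have h2 : s = t := by
      by_contra hne
      exact Set.disjoint_left.mp (h s t (Quotient.exact h1) hne) hx hy
    subst h2
    rfl
  · rintro ⟨⟨q, x⟩, hq, t, ht', ht⟩
    dsimp only at ht' hq ht
    subst ht'
    exact ⟨⟨(t, x), hq, ht⟩, rfl⟩

theorem mergeLeaves_represents_iff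
    (h : ∀ s t, C.leafSetoid s t → s ≠ t → Disjoint (C.label s) (C.label t)) {f : CovPoly V} :
    C.mergeLeaves.Represents f ↔ C.Represents f := by
  have hm : C.matrix =
      C.mergeLeaves.matrix.submatrix (C.mergeIndex true) (C.mergeIndex false) := by
    funext i j
    simp only [matrix, Matrix.submatrix_apply, mergeIndex]
    classical
    exact if_congr C.mergeLeaves_adj.symm rfl rfl
  let e (part : Bool) := Equiv.ofBijective _ (C.mergeIndex_bijective h part)
  have he : ∀ part, C.mergeIndex part = e part := fun _ => rfl
  constructor
  · rintro ⟨n, r, c, rfl⟩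
    refine ⟨n, r.trans (e true).symm, c.trans (e false).symm, ?_⟩
    congr 1
    funext i j
    simp [hm, he]
  · rintro ⟨n, r, c, rfl⟩
    refine ⟨n, r.trans (e true), c.trans (e false), ?_⟩
    congr 1
    funext i j
    simp [hm, he]

end GraphicalConstraint

/-! ### The expansion tree -/

namespace MixedGraph

variable {V : Type*} {G : MixedGraph V}

theorem isTreeNode_singleton {Y : V → Set V} {v x : V} : G.IsTreeNode Y v [x] ↔ x = v := by
  constructor
  · rintro ⟨⟩
    rfl
  · rintro rfl
    exact .seed

theorem isTreeNode_cons_cons {Y : V → Set V} {v x y : V} {l : List V} :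
    G.IsTreeNode Y v (y :: x :: l) ↔
      G.IsTreeNode Y v (x :: l) ∧ G.IsExpanded (x :: l) ∧ y ∈ Y x := by
  constructor
  · rintro ⟨⟩
    exact ⟨‹_›, ‹_›, ‹_›⟩
  · rintro ⟨h1, h2, h3⟩
    exact .child h1 h2 h3

theorem IsTreeNode.ne_nil {Y : V → Set V} {v : V} {l : List V} (h : G.IsTreeNode Y v l) :
    l ≠ [] := by
  cases h <;> simp

theorem IsTreeNode.of_tail {Y : V → Set V} {v : V} {l : List V} (h : G.IsTreeNode Y v l)
    (hl : l.tail ≠ []) : G.IsTreeNode Y v l.tail := by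
  cases h with
  | seed => simp at hl
  | child h _ _ => exact h

/-- A path read from its head follows directed edges towards the seed. Acyclicity then excludes
repetitions, which makes the tree finite. -/
theorem IsTreeNode.pairwise {v : V} {l : List V} (h : G.IsTreeNode G.pa v l) :
    l.Pairwise (Relation.TransGen G.dir) := by
  induction h with
  | seed => simp
  | child h _ hy ih =>
    refine List.pairwise_cons.mpr ⟨fun b hb => ?_, ih⟩
    rcases List.mem_cons.mp hb with rfl | hb
    · exact .single hy
    · exact .head hy ((List.pairwise_cons.mp ih).1 b hb)

theorem IsTreeNode.nodup (hG : G.IsAcyclic) {v : V} {l : List V} (h : G.IsTreeNode G.pa v l) :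
    l.Nodup :=
  h.pairwise.imp fun hab => by
    rintro rfl
    exact hG _ hab

/-- The nodes of the expansion tree of the half-trek construction. -/
abbrev TreeNode (G : MixedGraph V) (v w : V) : Type _ := (G.expansionTree G.pa v w).Node

namespace TreeNode

variable {v w : V}

/-- The original label of a node. -/
def var (p : G.TreeNode v w) : V := p.1.2.head p.2.ne_nil

/-- The part to which a node belongs. -/
def part (p : G.TreeNode v w) : Bool := (G.expansionTree G.pa v w).side p

/-- The seed nodes. -/
def root (G : MixedGraph V) (v w : V) (s : Bool) : G.TreeNode v w :=
  ⟨(s, [if s then v else w]), .seed⟩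

/-- The node `q` is not a seed. -/
def NonRoot (q : G.TreeNode v w) : Prop := q.1.2.tail ≠ []

/-- The node to which a node that is not a seed is attached. -/
def parent (q : G.TreeNode v w) (hq : q.NonRoot) : G.TreeNode v w :=
  ⟨(q.1.1, q.1.2.tail), q.2.of_tail hq⟩

theorem eq_root_or_nonRoot (p : G.TreeNode v w) : p = root G v w p.1.1 ∨ p.NonRoot := by
  obtain ⟨⟨s, _ | ⟨x, _ | ⟨y, l⟩⟩⟩, h⟩ := p
  · exact absurd rfl h.ne_nil
  · have := isTreeNode_singleton.mp h
    exact Or.inl (Subtype.ext (Prod.ext rfl (congrArg (fun x => [x]) this)))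
  · exact Or.inr (by simp [NonRoot])

theorem not_nonRoot_root (s : Bool) : ¬ (root G v w s).NonRoot := by simp [root, NonRoot]

theorem path_eq (q : G.TreeNode v w) (hq : q.NonRoot) :
    q.1.2 = q.var :: (q.parent hq).1.2 := (List.cons_head_tail q.2.ne_nil).symm

theorem ext_parent {p q : G.TreeNode v w} (hp : p.NonRoot) (hq : q.NonRoot)
    (h1 : p.parent hp = q.parent hq) (h2 : p.var = q.var) : p = q := by
  apply Subtype.ext
  apply Prod.ext
  · exact congrArg (fun x => x.1.1) h1
  · rw [path_eq p hp, path_eq q hq, h1, h2]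

/-- Adjacent nodes of the tree are two seeds, or a node and its parent. -/
theorem adj_iff {p q : G.TreeNode v w} : (G.expansionTree G.pa v w).graph.Adj p q ↔
    (∃ s, p = root G v w s ∧ q = root G v w !s) ∨ (∃ hp, p.parent hp = q) ∨
      (∃ hq, q.parent hq = p) := by
  have key : ∀ p q : G.TreeNode v w, (p.1.1 = q.1.1 ∧ ∃ y, p.1.2 = y :: q.1.2) ↔
      ∃ hp, p.parent hp = q := by
    intro p q
    constructor
    · rintro ⟨h1, y, h2⟩
      have hp : p.NonRoot := by
        simpa [NonRoot, h2] using q.2.ne_nil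
      refine ⟨hp, Subtype.ext (Prod.ext h1 ?_)⟩
      simp [parent, h2]
    · rintro ⟨hp, rfl⟩
      exact ⟨rfl, _, path_eq p hp⟩
  have h0 : (p.1.1 ≠ q.1.1 ∧ p.1.2.length = 1 ∧ q.1.2.length = 1) ↔
      ∃ s, p = root G v w s ∧ q = root G v w !s := by
    constructor
    · rintro ⟨h1, h2, h3⟩
      have hr : ∀ p : G.TreeNode v w, p.1.2.length = 1 → p = root G v w p.1.1 := by
        intro p hp
        refine p.eq_root_or_nonRoot.resolve_right fun h => h ?_
        exact List.eq_nil_of_length_eq_zero (by simp [hp])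
      refine ⟨p.1.1, hr p h2, ?_⟩
      have : q.1.1 = !p.1.1 := by
        revert h1
        cases p.1.1 <;> cases q.1.1 <;> simp
      rw [← this]
      exact hr q h3
    · rintro ⟨s, rfl, rfl⟩
      simp [root]
  rw [← key p q, ← key q p, ← h0]
  change (_ ∨ _) ↔ _
  rw [and_or_left, eq_comm (a := q.1.1)]
  tauto

theorem adj_parent (q : G.TreeNode v w) (hq : q.NonRoot) :
    (G.expansionTree G.pa v w).graph.Adj q (q.parent hq) := adj_iff.mpr (Or.inr (Or.inl ⟨hq, rfl⟩))

theorem part_root (s : Bool) : (root G v w s).part = s := by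
  change xor s _ = s
  simp [root]

theorem var_root (s : Bool) : (root G v w s).var = if s then v else w := rfl

theorem part_ne_of_adj {p q : G.TreeNode v w} (h : (G.expansionTree G.pa v w).graph.Adj p q) :
    p.part ≠ q.part := (G.expansionTree G.pa v w).side.valid h

theorem part_parent (q : G.TreeNode v w) (hq : q.NonRoot) : (q.parent hq).part = !q.part := by
  have := part_ne_of_adj (adj_parent q hq)
  revert this
  cases q.part <;> cases (q.parent hq).part <;> simp

theorem isExpanded_parent (q : G.TreeNode v w) (hq : q.NonRoot) :
    G.IsExpanded (q.parent hq).1.2 ∧ q.var ∈ G.pa (q.parent hq).var := by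
  obtain ⟨⟨s, _ | ⟨x, _ | ⟨y, l⟩⟩⟩, h⟩ := q
  · exact absurd rfl hq
  · exact absurd rfl hq
  · exact (isTreeNode_cons_cons.mp h).2

theorem isExpanded_iff (q : G.TreeNode v w) (hq : q.NonRoot) :
    G.IsExpanded q.1.2 ↔ q.var ∈ G.htr (q.parent hq).var := by
  obtain ⟨⟨s, _ | ⟨x, _ | ⟨y, l⟩⟩⟩, h⟩ := q
  · exact absurd rfl hq
  · exact absurd rfl hq
  · rfl

theorem mem_label_iff {p : G.TreeNode v w} {x : V} :
    x ∈ (G.expansionTree G.pa v w).label p ↔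
      x = p.var ∨ (x ∈ G.pa p.var ∧ G.IsExpanded p.1.2) := by
  obtain ⟨⟨s, _ | ⟨y, l⟩⟩, h⟩ := p
  · exact absurd rfl h.ne_nil
  · rfl

/-- The node attached to an expanded node for a parent `x` of its original label. -/
def child (p : G.TreeNode v w) (h : G.IsExpanded p.1.2) {x : V} (hx : x ∈ G.pa p.var) :
    G.TreeNode v w := by
  refine ⟨(p.1.1, x :: p.1.2), ?_⟩
  obtain ⟨⟨s, _ | ⟨y, l⟩⟩, h'⟩ := p
  · exact absurd rfl h'.ne_nil
  · exact .child h' h hx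

theorem child_nonRoot (p : G.TreeNode v w) (h : G.IsExpanded p.1.2) {x : V}
    (hx : x ∈ G.pa p.var) : (p.child h hx).NonRoot := p.2.ne_nil

theorem parent_child (p : G.TreeNode v w) (h : G.IsExpanded p.1.2) {x : V}
    (hx : x ∈ G.pa p.var) : (p.child h hx).parent (p.child_nonRoot h hx) = p := rfl

/-- A node to which another node is attached is not a leaf. -/
theorem not_isLeaf_parent (q : G.TreeNode v w) (hq : q.NonRoot) :
    ¬ (G.expansionTree G.pa v w).IsLeaf (q.parent hq) := by
  intro h
  have h1 : (G.expansionTree G.pa v w).graph.Adj (q.parent hq) q := (adj_parent q hq).symm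
  rcases (q.parent hq).eq_root_or_nonRoot with hr | hr
  · have h2 : (G.expansionTree G.pa v w).graph.Adj (q.parent hq)
        (root G v w !(q.parent hq).1.1) := adj_iff.mpr (Or.inl ⟨_, hr, rfl⟩)
    have := h.unique h1 h2
    exact not_nonRoot_root _ (this ▸ hq)
  · have := h.unique h1 (adj_parent _ hr)
    have := congrArg (fun x => x.1.2.length) this
    rw [path_eq q hq, path_eq _ hr] at this
    simp only [List.length_cons] at this
    omega

theorem label_of_isLeaf {p : G.TreeNode v w} (hp : (G.expansionTree G.pa v w).IsLeaf p) {x : V}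
    (hx : x ∈ (G.expansionTree G.pa v w).label p) : x = p.var := by
  refine (mem_label_iff.mp hx).resolve_right ?_
  rintro ⟨h, hexp⟩
  exact not_isLeaf_parent _ (p.child_nonRoot hexp h) hp

/-- A leaf carries only its original label, and siblings have distinct original labels. The
remaining collision is between a seed and a child of the other seed, which would make one of `v`,
`w` a parent of the other. -/
theorem disjoint_label (hvw : v ∉ G.pa w) (hwv : w ∉ G.pa v) (p q : G.TreeNode v w)
    (h : (G.expansionTree G.pa v w).leafSetoid p q) (hne : p ≠ q) :
    Disjoint ((G.expansionTree G.pa v w).label p) ((G.expansionTree G.pa v w).label q) := by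
  obtain ⟨hp, hq, u, hpu, hqu⟩ := h.resolve_left hne
  refine Set.disjoint_left.mpr fun x hx hx' => hne ?_
  have hvar : p.var = q.var := (label_of_isLeaf hp hx).symm.trans (label_of_isLeaf hq hx')
  have hseed : ∀ (p q : G.TreeNode v w) s, p = root G v w s → u = root G v w !s →
      p.var = q.var → ∀ hq : q.NonRoot, q.parent hq = u → False := by
    intro p q s hp hu hvar hq h1
    have := (isExpanded_parent q hq).2
    rw [h1, ← hvar, hp, hu, var_root, var_root] at this
    cases s
    · exact hwv this
    · exact hvw this
  rcases adj_iff.mp hpu with ⟨s, hs, hu⟩ | ⟨h1, h1'⟩ | ⟨h1, rfl⟩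
  · rcases adj_iff.mp hqu with ⟨t, ht, hu'⟩ | ⟨h2, h2'⟩ | ⟨h2, rfl⟩
    · have : (!s) = !t := by
        rw [hu] at hu'
        exact congrArg (fun x => x.1.1) hu'
      rw [hs, ht, Bool.not_inj this]
    · exact (hseed p q s hs hu hvar h2 h2').elim
    · exact absurd hq (not_isLeaf_parent _ h2)
  · rcases adj_iff.mp hqu with ⟨t, ht, hu'⟩ | ⟨h2, h2'⟩ | ⟨h2, rfl⟩
    · exact (hseed q p t ht hu' hvar.symm h1 h1').elim
    · exact ext_parent h1 h2 (h1'.trans h2'.symm) hvar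
    · exact absurd hq (not_isLeaf_parent _ h2)
  · exact absurd hp (not_isLeaf_parent _ h1)

theorem finite [Finite V] (hG : G.IsAcyclic) : Finite (G.TreeNode v w) := by
  classical
  have := Fintype.ofFinite V
  refine Finite.of_injective (β := Bool × {l : List V // l.Nodup})
    (fun p => (p.1.1, ⟨p.1.2, p.2.nodup hG⟩)) fun p q h => ?_
  obtain ⟨h1, h2⟩ := Prod.mk.inj h
  exact Subtype.ext (Prod.ext h1 (congrArg Subtype.val h2))

end TreeNode

end MixedGraph

/-! ### Row and column operations on the matrix of the tree -/

namespace MixedGraph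

variable {V : Type*} {G : MixedGraph V}

/-- The column of `1 - L` at `x` if `e` holds, and the standard basis vector at `x` otherwise. -/
noncomputable def mixedVec [DecidableEq V] {A : Type*} [CommRing A] (L : Matrix V V A) (e : Prop)
    (x : V) : V → A :=
  open Classical in if e then fun z => (1 - L) z x else Pi.single x 1

section mixedVec

variable [DecidableEq V] {A : Type*} [CommRing A] {L : Matrix V V A} {e : Prop} {x : V}

theorem mixedVec_of_pos (h : e) : mixedVec L e x = fun z => (1 - L) z x := if_pos h

theorem mixedVec_of_neg (h : ¬ e) : mixedVec L e x = Pi.single x 1 := if_neg h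

theorem mixedVec_map {B : Type*} [CommRing B] (φ : A →+* B) (z : V) :
    φ (mixedVec L e x z) = mixedVec (L.map φ) e x z := by
  by_cases h : e
  · simp only [mixedVec_of_pos h, Matrix.sub_apply, Matrix.map_apply, map_sub, Matrix.one_apply,
      apply_ite φ, map_one, map_zero]
  · simp only [mixedVec_of_neg h, Pi.single_apply, apply_ite φ, map_one, map_zero]

theorem mixedVec_zero : mixedVec (0 : Matrix V V A) e x = Pi.single x 1 := by
  by_cases h : e
  · rw [mixedVec_of_pos h]
    funext z
    simp [Matrix.one_apply, Pi.single_apply]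
  · rw [mixedVec_of_neg h]

end mixedVec

/-- `L` is supported on the directed edges and solves the equations by which the half-trek criterion
identifies the directed edge coefficients from the covariance matrix `S`. -/
structure IsSolution [Fintype V] [DecidableEq V] (G : MixedGraph V) {A : Type*} [CommRing A]
    (S L : Matrix V V A) : Prop where
  support : ∀ x y, ¬ G.dir x y → L x y = 0
  eq_zero : ∀ x y, G.dir x y →
    mixedVec L (x ∈ G.htr y) x ⬝ᵥ S.mulVec (mixedVec L True y) = 0

theorem dotProduct_mulVec_comm [Fintype V] {A : Type*} [CommRing A] {S : Matrix V V A}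
    (hS : S.IsSymm) (a b : V → A) : a ⬝ᵥ S.mulVec b = b ⬝ᵥ S.mulVec a := by
  rw [Matrix.dotProduct_mulVec, dotProduct_comm, ← Matrix.mulVec_transpose, hS.eq]

/-- The index type of the rows (`s = true`) or columns (`s = false`) of the expansion tree. -/
abbrev TreeIndex (G : MixedGraph V) (v w : V) (s : Bool) : Type _ :=
  (G.expansionTree G.pa v w).Index s

/-- The nodes other than the seeds, and one element `none` that stands for the pair of seeds. -/
abbrev TreeEdge (G : MixedGraph V) (v w : V) : Type _ :=
  Option {q : G.TreeNode v w // q.NonRoot}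

namespace TreeIndex

open TreeNode

variable {v w : V} {s : Bool}

/-- The node of an index. -/
def node (i : G.TreeIndex v w s) : G.TreeNode v w := i.1.1

/-- The element of the label of the node of an index. -/
def lab (i : G.TreeIndex v w s) : V := i.1.2

theorem ext_node_lab {i j : G.TreeIndex v w s} (h1 : i.node = j.node) (h2 : i.lab = j.lab) :
    i = j := Subtype.ext (Prod.ext h1 h2)

theorem lab_mem (i : G.TreeIndex v w s) : i.lab ∈ (G.expansionTree G.pa v w).label i.node := i.2.2

/-- The index `(t, u)` of a node `t` with original label `{u}`. -/
def own (p : G.TreeNode v w) (hp : p.part = s) : G.TreeIndex v w s :=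
  ⟨(p, p.var), hp, mem_label_iff.mpr (Or.inl rfl)⟩

/-- The index `(t, y)` that the creation of the node `t_y` adds to the node `t`. -/
def ofChild (q : G.TreeNode v w) (hq : q.NonRoot) (h : q.part ≠ s) : G.TreeIndex v w s :=
  ⟨(q.parent hq, q.var), by
    change (q.parent hq).part = s
    rw [part_parent]
    revert h
    cases q.part <;> cases s <;> simp,
    mem_label_iff.mpr (Or.inr (isExpanded_parent q hq).symm)⟩

/-- The rows and columns are both indexed by the edges of the tree. -/
def ofEdge (s : Bool) : G.TreeEdge v w → G.TreeIndex v w s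
  | none => own (root G v w s) (part_root s)
  | some q => if h : q.1.part = s then own q.1 h else ofChild q.1 q.2 h

/-- The index of an original label corresponds to the edge from its node to the parent node, or to
the edge between the seeds. Any other index `(t, y)` corresponds to the edge from `t` to `t_y`. The
two kinds differ because no node of `G` is its own parent. Hence the matrix is square. -/
theorem ofEdge_bijective (hG : G.IsAcyclic) (s : Bool) :
    Function.Bijective (ofEdge (G := G) (v := v) (w := w) s) := by
  have hne : ∀ (p q : G.TreeNode v w) (hp : p.part = s) (hq : q.NonRoot) (h : q.part ≠ s),
      own p hp ≠ ofChild q hq h := by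
    intro p q hp hq h heq
    have h1 : p = q.parent hq := congrArg node heq
    have h2 : p.var = q.var := congrArg lab heq
    have h3 := (isExpanded_parent q hq).2
    rw [← h2, ← h1] at h3
    exact hG _ (.single h3)
  constructor
  · rintro (_ | q) (_ | q') h
    · rfl
    · simp only [ofEdge] at h
      split_ifs at h with h'
      · have h1 : root G v w s = q'.1 := congrArg node h
        exact absurd (h1 ▸ q'.2) (not_nonRoot_root s)
      · exact absurd h (hne _ _ _ _ _)
    · simp only [ofEdge] at h
      split_ifs at h with h'
      · have h1 : q.1 = root G v w s := congrArg node h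
        exact absurd (h1 ▸ q.2) (not_nonRoot_root s)
      · exact absurd h.symm (hne _ _ _ _ _)
    · simp only [ofEdge] at h
      congr 1
      apply Subtype.ext
      split_ifs at h with h1 h2 h2
      · exact congrArg node h
      · exact absurd h (hne _ _ _ _ _)
      · exact absurd h.symm (hne _ _ _ _ _)
      · exact ext_parent q.2 q'.2 (congrArg node h) (congrArg lab h)
  · rintro ⟨⟨p, x⟩, hp, hx⟩
    change G.TreeNode v w at p
    change p.part = s at hp
    rcases mem_label_iff.mp hx with h | ⟨h1, h2⟩
    · dsimp only at h
      subst h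
      rcases p.eq_root_or_nonRoot with h | h
      · refine ⟨none, Subtype.ext ?_⟩
        have h' : p.1.1 = s := by
          rw [← hp, h, part_root]
          rfl
        rw [h'] at h
        exact Prod.ext h.symm (congrArg TreeNode.var h.symm)
      · refine ⟨some ⟨p, h⟩, ?_⟩
        simp only [ofEdge]
        rw [dif_pos hp]
        rfl
    · refine ⟨some ⟨p.child h2 h1, child_nonRoot p h2 h1⟩, ?_⟩
      simp only [ofEdge]
      rw [dif_neg]
      · rfl
      · have h3 := part_parent (p.child h2 h1) (child_nonRoot p h2 h1)
        rw [parent_child] at h3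
        intro h4
        rw [hp, h4] at h3
        cases s <;> simp at h3

variable [DecidableEq V] {A : Type*} [CommRing A]

/-- The vector by which the row (or column) with index `i` is replaced, expressed in terms of the
rows that belong to the same node. -/
noncomputable def vec (L : Matrix V V A) (i : G.TreeIndex v w s) : V → A :=
  mixedVec L (i.lab = i.node.var ∧ G.IsExpanded i.node.1.2) i.lab

theorem vec_own (L : Matrix V V A) (p : G.TreeNode v w) (hp : p.part = s) :
    vec L (own p hp) = mixedVec L (G.IsExpanded p.1.2) p.var := by
  simp [vec, own, node, lab]

/-- The column of `1 - L` at `u` is supported on `{u} ∪ pa u`, the label of an expanded node. So the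
operations combine only rows that exist. -/
theorem vec_eq_zero {L : Matrix V V A} (hL : ∀ x y, ¬ G.dir x y → L x y = 0)
    (i : G.TreeIndex v w s) {x : V} (hx : x ∉ (G.expansionTree G.pa v w).label i.node) :
    vec L i x = 0 := by
  rw [mem_label_iff, not_or, not_and] at hx
  by_cases h : i.lab = i.node.var ∧ G.IsExpanded i.node.1.2
  · rw [vec, mixedVec_of_pos h]
    dsimp only
    rw [Matrix.sub_apply, h.1, Matrix.one_apply_ne hx.1,
      hL _ _ fun h' => hx.2 h' h.2, sub_zero]
  · rw [vec, mixedVec_of_neg h, Pi.single_apply, if_neg]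
    rintro rfl
    exact absurd (mem_label_iff.mp i.lab_mem) (by simpa using hx)

open Classical in
/-- The matrix of the row operations. -/
noncomputable def opMatrix (G : MixedGraph V) (v w : V) (s : Bool) (L : Matrix V V A) :
    Matrix (G.TreeIndex v w s) (G.TreeIndex v w s) A :=
  fun i j => if i.node = j.node then vec L i j.lab else 0

theorem sum_opMatrix [Fintype V] [Fintype (G.TreeIndex v w s)] {L : Matrix V V A}
    (hL : ∀ x y, ¬ G.dir x y → L x y = 0) (i : G.TreeIndex v w s) (F : G.TreeNode v w → V → A) :
    ∑ j, opMatrix G v w s L i j * F j.node j.lab = ∑ x, vec L i x * F i.node x := by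
  classical
  rw [← Finset.sum_subset (Finset.subset_univ
    ({x : V | x ∈ (G.expansionTree G.pa v w).label i.node} : Finset V))]
  · refine Finset.sum_bij_ne_zero (fun j _ _ => j.lab) ?_ ?_ ?_ ?_
    · intro j _ hj
      have h1 : i.node = j.node := by
        by_contra h
        simp [opMatrix, h] at hj
      simpa [h1] using j.lab_mem
    · intro j _ hj j' _ hj' hjj'
      have h1 : i.node = j.node := by
        by_contra h
        simp [opMatrix, h] at hj
      have h2 : i.node = j'.node := by
        by_contra h
        simp [opMatrix, h] at hj'
      exact ext_node_lab (h1.symm.trans h2) hjj'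
    · intro x hx hx'
      refine ⟨⟨(i.node, x), i.2.1, by simpa using hx⟩, Finset.mem_univ _, ?_, rfl⟩
      have : ∀ j : G.TreeIndex v w s, i.node = j.node → x = j.lab →
          opMatrix G v w s L i j * F j.node j.lab ≠ 0 := by
        rintro j h1 rfl
        rw [opMatrix, if_pos h1, ← h1]
        exact hx'
      exact this _ rfl rfl
    · intro j _ hj
      have h1 : i.node = j.node := by
        by_contra h
        simp [opMatrix, h] at hj
      simp [opMatrix, h1]
  · intro x _ hx
    rw [vec_eq_zero hL i (by simpa using hx), zero_mul]

/-- Only the rows of original labels are changed, by adding multiples of other rows of the same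
node, so the matrix is unitriangular. -/
theorem det_opMatrix (hG : G.IsAcyclic) [Fintype (G.TreeIndex v w s)]
    [DecidableEq (G.TreeIndex v w s)] {L : Matrix V V A}
    (hL : ∀ x y, ¬ G.dir x y → L x y = 0) : (opMatrix G v w s L).det = 1 := by
  classical
  have h0 : ∀ i j : G.TreeIndex v w s, i.lab ≠ i.node.var → opMatrix G v w s L i j =
      if i = j then 1 else 0 := by
    intro i j hi
    simp only [opMatrix, vec]
    rw [mixedVec_of_neg fun h => hi h.1]
    by_cases h : i.node = j.node
    · simp only [if_pos h, Pi.single_apply]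
      refine if_congr ⟨fun h' => ext_node_lab h h'.symm, ?_⟩ rfl rfl
      rintro rfl
      rfl
    · rw [if_neg h, if_neg]
      rintro rfl
      exact h rfl
  rw [Matrix.twoBlockTriangular_det _ fun i => i.lab = i.node.var]
  · have h1 : Matrix.toSquareBlockProp (opMatrix G v w s L) (fun i => i.lab = i.node.var) = 1 := by
      funext i j
      simp only [Matrix.toSquareBlockProp_def, Matrix.one_apply, opMatrix, Matrix.of_apply]
      by_cases h : i.1.node = j.1.node
      · have hij : i = j := Subtype.ext (ext_node_lab h
          (i.2.trans ((congrArg TreeNode.var h).trans j.2.symm)))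
        subst hij
        rw [if_pos rfl, if_pos rfl, vec]
        by_cases h' : i.1.lab = i.1.node.var ∧ G.IsExpanded i.1.node.1.2
        · rw [mixedVec_of_pos h']
          dsimp only
          rw [Matrix.sub_apply, Matrix.one_apply_eq,
            hL _ _ fun h => hG _ (.single h), sub_zero]
        · rw [mixedVec_of_neg h', Pi.single_eq_same]
      · rw [if_neg h, if_neg]
        rintro rfl
        exact h rfl
    have h2 : Matrix.toSquareBlockProp (opMatrix G v w s L) (fun i => ¬ i.lab = i.node.var) = 1 := by
      funext i j
      rw [Matrix.toSquareBlockProp_def, Matrix.of_apply, h0 _ _ i.2, Matrix.one_apply]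
      exact if_congr Subtype.ext_iff.symm rfl rfl
    rw [h1, h2, Matrix.det_one, Matrix.det_one, mul_one]
  · intro i hi j hj
    rw [h0 i j hi, if_neg]
    rintro rfl
    exact hi hj

open Classical in
/-- The matrix of the expansion tree after the row and column operations. -/
noncomputable def reduced [Fintype V] (G : MixedGraph V) (v w : V) (S L : Matrix V V A) :
    Matrix (G.TreeIndex v w true) (G.TreeIndex v w false) A :=
  fun i j => if (G.expansionTree G.pa v w).graph.Adj i.node j.node then
    vec L i ⬝ᵥ S.mulVec (vec L j) else 0

/-- The operations stay inside a node, and the zero pattern depends on the nodes only, so it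
survives. -/
theorem opMatrix_mul_mul [Fintype V] [Fintype (G.TreeIndex v w true)]
    [Fintype (G.TreeIndex v w false)] {S L : Matrix V V A}
    (hL : ∀ x y, ¬ G.dir x y → L x y = 0) (φ : CovPoly V →+* A)
    (hφ : ∀ x y, φ (MvPolynomial.X s(x, y)) = S x y) :
    opMatrix G v w true L * (G.expansionTree G.pa v w).matrix.map φ *
      (opMatrix G v w false L).transpose = reduced G v w S L := by
  classical
  funext i j
  have hM : ∀ (a : G.TreeIndex v w true) (b : G.TreeIndex v w false),
      (G.expansionTree G.pa v w).matrix.map φ a b =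
      if (G.expansionTree G.pa v w).graph.Adj a.node b.node then S a.lab b.lab else 0 := by
    intro a b
    rw [Matrix.map_apply, GraphicalConstraint.matrix, apply_ite φ, hφ, map_zero]
    rfl
  rw [Matrix.mul_apply]
  simp_rw [Matrix.mul_apply, hM, Matrix.transpose_apply]
  have h1 : ∀ b : G.TreeIndex v w false, ∑ a, opMatrix G v w true L i a *
      (if (G.expansionTree G.pa v w).graph.Adj a.node b.node then S a.lab b.lab else 0) =
      ∑ x, vec L i x *
      (if (G.expansionTree G.pa v w).graph.Adj i.node b.node then S x b.lab else 0) := fun b =>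
    sum_opMatrix hL i fun p x =>
      if (G.expansionTree G.pa v w).graph.Adj p b.node then S x b.lab else 0
  simp_rw [h1, mul_comm _ (opMatrix G v w false L _ _)]
  rw [sum_opMatrix hL j fun p y => ∑ x, vec L i x *
      (if (G.expansionTree G.pa v w).graph.Adj i.node p then S x y else 0)]
  by_cases h : (G.expansionTree G.pa v w).graph.Adj i.node j.node
  · simp only [reduced, if_pos h, dotProduct, Matrix.mulVec, Finset.mul_sum]
    rw [Finset.sum_comm]
    refine Finset.sum_congr rfl fun x _ => Finset.sum_congr rfl fun y _ => ?_
    ring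
  · simp [reduced, if_neg h]

end TreeIndex

namespace TreeEdge

open TreeNode TreeIndex

variable {v w : V}

/-- The matrix of the expansion tree after the row and column operations, with rows and columns
indexed by the edges of the tree. -/
noncomputable def reduced [Fintype V] [DecidableEq V] {A : Type*} [CommRing A]
    (G : MixedGraph V) (v w : V) (S L : Matrix V V A) :
    Matrix (G.TreeEdge v w) (G.TreeEdge v w) A :=
  (TreeIndex.reduced G v w S L).submatrix (ofEdge true) (ofEdge false)

theorem exists_represents [Finite V] (hG : G.IsAcyclic) :
    ∃ f, (G.expansionTree G.pa v w).Represents f := by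
  have := TreeNode.finite (v := v) (w := w) hG
  let e := (Finite.equivFin (G.TreeEdge v w)).symm
  exact ⟨_, _, e.trans (Equiv.ofBijective _ (ofEdge_bijective hG true)),
    e.trans (Equiv.ofBijective _ (ofEdge_bijective hG false)), rfl⟩

theorem map_of_represents [Fintype V] [DecidableEq V] {A : Type*} [CommRing A]
    [Fintype (G.TreeEdge v w)] [DecidableEq (G.TreeEdge v w)]
    (hG : G.IsAcyclic) {f : CovPoly V}
    (hf : (G.expansionTree G.pa v w).Represents f) {S L : Matrix V V A}
    (hL : ∀ x y, ¬ G.dir x y → L x y = 0) (φ : CovPoly V →+* A)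
    (hφ : ∀ x y, φ (MvPolynomial.X s(x, y)) = S x y) :
    ∃ ε : ℤˣ, φ f = ((ε : ℤ) : A) * (reduced G v w S L).det := by
  classical
  obtain ⟨n, r, c, rfl⟩ := hf
  let e (s : Bool) := Equiv.ofBijective _ (ofEdge_bijective (v := v) (w := w) hG s)
  let _ := Fintype.ofEquiv _ r
  let _ := Fintype.ofEquiv _ c
  have h1 : φ ((G.expansionTree G.pa v w).matrix.submatrix r c).det =
      ((TreeIndex.reduced G v w S L).submatrix r c).det := by
    rw [← opMatrix_mul_mul hL φ hφ, ← Matrix.submatrix_mul_equiv _ _ _ c _,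
      ← Matrix.submatrix_mul_equiv _ _ _ r _, Matrix.det_mul, Matrix.det_mul,
      Matrix.det_submatrix_equiv_self, Matrix.det_submatrix_equiv_self, Matrix.det_transpose,
      det_opMatrix hG hL, det_opMatrix hG hL, one_mul, mul_one, RingHom.map_det]
    rfl
  let k : G.TreeEdge v w ≃ Fin n := (e true).trans r.symm
  -- Once the rows are ordered by edges, σ is the discrepancy between the given column order and the
  -- one by edges; its sign is the undetermined sign.
  let σ : Equiv.Perm (G.TreeEdge v w) := (k.trans c).trans (e false).symm
  refine ⟨Equiv.Perm.sign σ, ?_⟩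
  rw [h1, ← Matrix.det_permute', ← Matrix.det_submatrix_equiv_self k]
  congr 1
  funext i j
  have h2 : r (k i) = ofEdge true i := r.apply_symm_apply _
  have h3 : c (k j) = ofEdge false (σ j) := ((e false).apply_symm_apply _).symm
  simp only [Matrix.submatrix_apply, reduced, h2, h3, id]

end TreeEdge

end MixedGraph

/-! ### Block triangular form and the cofactor -/

namespace MixedGraph

variable {V : Type*} {G : MixedGraph V}

namespace TreeEdge

open TreeNode TreeIndex

variable {v w : V}

/-- The order of the blocks with respect to which `reduced` is block triangular. -/
def rank : G.TreeEdge v w → Fin 3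
  | none => 1
  | some q => if q.1.part = true then 2 else 0

theorem ofEdge_true_of_rank {i : G.TreeEdge v w} (hi : rank i = 2) :
    ∃ q, ∃ (h : q.1.part = true), i = some q ∧ ofEdge true i = own q.1 h := by
  rcases i with _ | q
  · simp [rank] at hi
  · have h : q.1.part = true := by
      by_contra h
      simp [rank, h] at hi
    exact ⟨q, h, rfl, dif_pos h⟩

theorem ofEdge_false_of_rank {i : G.TreeEdge v w} (hi : rank i = 0) :
    ∃ q, ∃ (h : q.1.part = false), i = some q ∧ ofEdge false i = own q.1 h := by
  rcases i with _ | q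
  · simp [rank] at hi
  · have h : q.1.part = false := by
      by_contra h
      simp [rank, h] at hi
    exact ⟨q, h, rfl, dif_pos h⟩

theorem eq_none_of_rank {i : G.TreeEdge v w} (hi : rank i = 1) : i = none := by
  rcases i with _ | q
  · rfl
  · by_cases h : q.1.part = true <;> simp [rank, h] at hi

theorem exists_represents_htcConstraint [Finite V] (hG : G.IsAcyclic) (hvw : v ∉ G.pa w)
    (hwv : w ∉ G.pa v) : ∃ f, (G.htcConstraint G.pa v w).Represents f := by
  obtain ⟨f, hf⟩ := exists_represents (v := v) (w := w) hG
  refine ⟨f, ?_⟩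
  rwa [htcConstraint, GraphicalConstraint.mergeLeaves_represents_iff _ (disjoint_label hvw hwv)]

variable [Fintype V] [DecidableEq V]

section CommRing

variable {A : Type*} [CommRing A] {S L : Matrix V V A}

/-- Adjacent nodes that are not both seeds are some `t_y` and its parent node `t`, with original
label `u`. Since `t` is expanded, and `t_y` is expanded iff `y ∈ htr u`, the entry is the half-trek
equation of the edge `y → u`. -/
theorem reduced_own_own (hS : S.IsSymm) (hL : G.IsSolution S L) {p q : G.TreeNode v w}
    (hp : p.part = true) (hq : q.part = false) (h : p.NonRoot ∨ q.NonRoot) :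
    TreeIndex.reduced G v w S L (own p hp) (own q hq) = 0 := by
  have key : ∀ (q : G.TreeNode v w) (hq : q.NonRoot),
      mixedVec L (G.IsExpanded q.1.2) q.var ⬝ᵥ
        S.mulVec (mixedVec L (G.IsExpanded (q.parent hq).1.2) (q.parent hq).var) = 0 := by
    intro q hq
    obtain ⟨h1, h2⟩ := isExpanded_parent q hq
    have := hL.eq_zero _ _ h2
    rwa [← propext (isExpanded_iff q hq), ← eq_true h1] at this
  classical
  rw [TreeIndex.reduced]
  refine ite_eq_right_iff.mpr fun hadj => ?_
  rw [vec_own, vec_own]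
  rcases adj_iff.mp hadj with ⟨s, h1, h2⟩ | ⟨hp', h1⟩ | ⟨hq', h1⟩
  · change p = _ at h1
    change q = _ at h2
    rw [h1, h2] at h
    exact (h.elim (not_nonRoot_root _) (not_nonRoot_root _)).elim
  · change p.parent hp' = q at h1
    rw [← h1]
    exact key p hp'
  · change q.parent hq' = p at h1
    rw [← h1, dotProduct_mulVec_comm hS]
    exact key q hq'

/-- Rows of rank at least 1 and columns of rank at most 1 belong to original labels, so below the
diagonal blocks `reduced_own_own` applies. -/
theorem blockTriangular_reduced (hS : S.IsSymm) (hL : G.IsSolution S L) :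
    (reduced G v w S L).BlockTriangular rank := by
  intro i j hij
  have h3 : ∀ a : Fin 3, a = 0 ∨ a = 1 ∨ a = 2 := by decide
  rcases h3 (rank i) with hi | hi | hi <;> rcases h3 (rank j) with hj | hj | hj <;>
    rw [hi, hj] at hij <;> try exact absurd hij (by decide)
  · obtain ⟨q, hq, rfl, h⟩ := ofEdge_false_of_rank hj
    obtain rfl := eq_none_of_rank hi
    rw [reduced, Matrix.submatrix_apply, h]
    exact reduced_own_own hS hL (part_root true) hq (Or.inr q.2)
  · obtain ⟨q, hq, rfl, h⟩ := ofEdge_true_of_rank hi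
    obtain ⟨q', hq', rfl, h'⟩ := ofEdge_false_of_rank hj
    rw [reduced, Matrix.submatrix_apply, h, h']
    exact reduced_own_own hS hL hq hq' (Or.inr q'.2)
  · obtain ⟨q, hq, rfl, h⟩ := ofEdge_true_of_rank hi
    obtain rfl := eq_none_of_rank hj
    rw [reduced, Matrix.submatrix_apply, h]
    exact reduced_own_own hS hL hq (part_root false) (Or.inl q.2)

theorem map_reduced {B : Type*} [CommRing B] (φ : A →+* B) :
    (reduced G v w S L).map φ = reduced G v w (S.map φ) (L.map φ) := by
  funext i j
  simp only [Matrix.map_apply, reduced, Matrix.submatrix_apply, TreeIndex.reduced, apply_ite φ,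
    map_zero, dotProduct, Matrix.mulVec, map_sum, map_mul, vec, mixedVec_map]

/-- At this point an entry is 1 iff the nodes are adjacent and the labels agree. In the outer
diagonal blocks this forces equal edges, since the other possibility, a node and its grandchild with
the same original label, contradicts acyclicity. -/
theorem reduced_one_zero [DecidableEq (G.TreeEdge v w)] (hG : G.IsAcyclic) (i j : G.TreeEdge v w)
    (hij : rank i = rank j) (hi : rank i ≠ 1) :
    reduced G v w (1 : Matrix V V A) 0 i j = if i = j then 1 else 0 := by
  classical
  have key : ∀ (q q' : G.TreeNode v w) (hq' : q'.NonRoot), q.NonRoot →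
      (G.expansionTree G.pa v w).graph.Adj q (q'.parent hq') → q.var = q'.var → q = q' := by
    intro q q' hq' hq hadj hvar
    rcases adj_iff.mp hadj with ⟨s, h1, h2⟩ | ⟨hp, h1⟩ | ⟨hp, h1⟩
    · rw [h1] at hq
      exact (not_nonRoot_root _ hq).elim
    · exact ext_parent hp hq' h1 hvar
    · have h2 := q'.2.nodup hG
      have h3 := path_eq q' hq'
      have h4 := path_eq _ hp
      rw [h1, path_eq q hq] at h4
      rw [h3, h4, hvar] at h2
      simp at h2
  have h3 : ∀ a : Fin 3, a = 0 ∨ a = 1 ∨ a = 2 := by decide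
  rw [reduced, Matrix.submatrix_apply, TreeIndex.reduced]
  simp only [vec, mixedVec_zero, Matrix.one_mulVec, single_one_dotProduct, Pi.single_apply]
  rw [← ite_and]
  refine if_congr ?_ rfl rfl
  rcases h3 (rank i) with h | h | h
  · obtain ⟨q, hq, rfl, -⟩ := ofEdge_false_of_rank h
    obtain ⟨q', hq', rfl, h'⟩ := ofEdge_false_of_rank (hij ▸ h)
    rw [h', ofEdge, dif_neg (by simp [hq])]
    constructor
    · rintro ⟨h1, h2⟩
      exact congrArg some (Subtype.ext (key _ _ q.2 q'.2 h1.symm h2.symm).symm)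
    · intro h1
      obtain rfl := Option.some.inj h1
      exact ⟨(adj_parent q.1 q.2).symm, rfl⟩
  · exact absurd h hi
  · obtain ⟨q, hq, rfl, h'⟩ := ofEdge_true_of_rank h
    obtain ⟨q', hq', rfl, -⟩ := ofEdge_true_of_rank (hij ▸ h)
    rw [h', ofEdge, dif_neg (by simp [hq'])]
    constructor
    · rintro ⟨h1, h2⟩
      exact congrArg some (Subtype.ext (key _ _ q'.2 q.2 h1 h2))
    · intro h1
      obtain rfl := Option.some.inj h1
      exact ⟨adj_parent q.1 q.2, rfl⟩

variable [Fintype (G.TreeEdge v w)] [DecidableEq (G.TreeEdge v w)]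

/-- The factor by which the polynomial of a graphical constraint differs from an entry of the
matrix `(1 - L)ᵀ S (1 - L)`. -/
noncomputable def cofactor (G : MixedGraph V) (v w : V) [Fintype (G.TreeEdge v w)]
    [DecidableEq (G.TreeEdge v w)] (S L : Matrix V V A) : A :=
  ((reduced G v w S L).toSquareBlock rank 0).det * ((reduced G v w S L).toSquareBlock rank 2).det

theorem det_reduced (hS : S.IsSymm) (hL : G.IsSolution S L) :
    (reduced G v w S L).det = cofactor G v w S L *
      (mixedVec L True v ⬝ᵥ S.mulVec (mixedVec L True w)) := by
  -- The middle block is 1×1: it belongs to the two seeds, both expanded.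
  have h1 : ((reduced G v w S L).toSquareBlock rank 1).det =
      mixedVec L True v ⬝ᵥ S.mulVec (mixedVec L True w) := by
    have hsub : Subsingleton {i : G.TreeEdge v w // rank i = 1} :=
      ⟨fun i j => Subtype.ext ((eq_none_of_rank i.2).trans (eq_none_of_rank j.2).symm)⟩
    rw [Matrix.det_eq_elem_of_subsingleton _ (⟨none, rfl⟩ : {i : G.TreeEdge v w // rank i = 1})]
    change TreeIndex.reduced G v w S L (own (root G v w true) (part_root true))
      (own (root G v w false) (part_root false)) = _
    rw [TreeIndex.reduced, if_pos, vec_own, vec_own]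
    · rfl
    · exact adj_iff.mpr (Or.inl ⟨true, rfl, rfl⟩)
  rw [(blockTriangular_reduced hS hL).det_fintype, Fin.prod_univ_three, h1, cofactor]
  ring

theorem map_cofactor {B : Type*} [CommRing B] (φ : A →+* B) :
    φ (cofactor G v w S L) = cofactor G v w (S.map φ) (L.map φ) := by
  rw [cofactor, cofactor, map_mul, RingHom.map_det, RingHom.map_det, ← map_reduced]
  rfl

theorem cofactor_one_zero (hG : G.IsAcyclic) : cofactor G v w (1 : Matrix V V A) 0 = 1 := by
  have h : ∀ a : Fin 3, a ≠ 1 →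
      (reduced G v w (1 : Matrix V V A) 0).toSquareBlock rank a = 1 := by
    intro a ha
    funext i j
    rw [Matrix.toSquareBlock_def, Matrix.of_apply,
      reduced_one_zero hG _ _ (i.2.trans j.2.symm) (by rwa [i.2]), Matrix.one_apply]
    exact if_congr Subtype.ext_iff.symm rfl rfl
  rw [cofactor, h 0 (by decide), h 2 (by decide), Matrix.det_one, Matrix.det_one, one_mul]

end CommRing

/-- The polynomial of a graphical constraint, evaluated at `S`, is an entry of
`(1 - L)ᵀ S (1 - L)`, up to sign and `cofactor`. -/
theorem map_of_represents_htcConstraint (hG : G.IsAcyclic) [Fintype (G.TreeEdge v w)]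
    [DecidableEq (G.TreeEdge v w)]
    (hvw : v ∉ G.pa w) (hwv : w ∉ G.pa v) {f : CovPoly V}
    (hf : (G.htcConstraint G.pa v w).Represents f) {A : Type*} [CommRing A] {S L : Matrix V V A}
    (hS : S.IsSymm) (hL : G.IsSolution S L) (φ : CovPoly V →+* A)
    (hφ : ∀ x y, φ (MvPolynomial.X s(x, y)) = S x y) :
    ∃ ε : ℤˣ, φ f = ((ε : ℤ) : A) * (cofactor G v w S L *
      (mixedVec L True v ⬝ᵥ S.mulVec (mixedVec L True w))) := by
  rw [htcConstraint,
    GraphicalConstraint.mergeLeaves_represents_iff _ (disjoint_label hvw hwv)] at hf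
  rw [← det_reduced hS hL]
  exact map_of_represents hG hf hL.support φ hφ

end TreeEdge

end MixedGraph

/-! ### The cofactor is a unit in the fraction ring -/

namespace CovFrac

open CovPoly MixedGraph

variable {V : Type*} [DecidableEq V]

/-- The generic symmetric matrix. -/
noncomputable def genericMatrix (V : Type*) [DecidableEq V] : Matrix V V (CovFrac V) :=
  fun x y => algebraMap (CovPoly V) (CovFrac V) (MvPolynomial.X s(x, y))

theorem isSymm_genericMatrix : (genericMatrix V).IsSymm :=
  Matrix.IsSymm.ext fun x y => by rw [genericMatrix, genericMatrix, Sym2.eq_swap]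

theorem genericMatrix_map_evalOne : (genericMatrix V).map evalOne = 1 := by
  funext x y
  rw [Matrix.map_apply, genericMatrix, evalOne_algebraMap, CovPoly.evalOne_X]

/-- The entries of the column of `L` at `y` are `V`-homogeneous, of the multidegree of edge
coefficients, and vanish at the identity matrix. -/
structure IsHomogeneousAt (L : Matrix V V (CovFrac V)) (y : V) : Prop where
  isHomogeneous : ∀ x, IsHomogeneous (Pi.single y 1 - Pi.single x 1) (L x y)
  evalOne_eq_zero : ∀ x, evalOne (L x y) = 0

theorem IsHomogeneousAt.mixedVec {L : Matrix V V (CovFrac V)} {e : Prop} {y : V}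
    (hL : e → IsHomogeneousAt L y) (x : V) :
    IsHomogeneous (Pi.single y 1 - Pi.single x 1) (mixedVec L e y x) := by
  have h1 : IsHomogeneous (Pi.single y 1 - Pi.single x 1) (if x = y then (1 : CovFrac V) else 0) := by
    split_ifs with h
    · rw [h, sub_self]
      exact .one
    · exact .zero _
  by_cases h : e
  · rw [mixedVec_of_pos h]
    dsimp only
    rw [Matrix.sub_apply, Matrix.one_apply]
    exact h1.sub ((hL h).isHomogeneous x)
  · rwa [mixedVec_of_neg h, Pi.single_apply]

theorem IsHomogeneous.form [Fintype V] {a b : V → CovFrac V} {y z : V}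
    (ha : ∀ x, IsHomogeneous (Pi.single y 1 - Pi.single x 1) (a x))
    (hb : ∀ x, IsHomogeneous (Pi.single z 1 - Pi.single x 1) (b x)) :
    IsHomogeneous (Pi.single y 1 + Pi.single z 1) (a ⬝ᵥ (genericMatrix V).mulVec b) := by
  simp only [dotProduct, Matrix.mulVec, Finset.mul_sum]
  refine .sum _ fun x _ => .sum _ fun x' _ => ?_
  have := (ha x).mul ((IsHomogeneous.X x x').mul (hb x'))
  convert this using 1
  · abel
  · rfl

/-- The operations keep each entry homogeneous, of degree given by its row and column labels. So the
two block determinants are homogeneous, and their product specializes to `cofactor_one_zero` at the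
identity. -/
theorem isUnit_cofactor [Fintype V] {G : MixedGraph V} (hG : G.IsAcyclic)
    {L : Matrix V V (CovFrac V)} (hL : ∀ y, IsHomogeneousAt L y) (v w : V)
    [Fintype (G.TreeEdge v w)] [DecidableEq (G.TreeEdge v w)] :
    IsUnit (TreeEdge.cofactor G v w (genericMatrix V) L) := by
  have h0 : L.map evalOne = 0 := by
    funext x y
    exact (hL y).evalOne_eq_zero x
  have h1 : ∀ i j, IsHomogeneous (Pi.single (TreeIndex.ofEdge true i).lab 1 +
      Pi.single (TreeIndex.ofEdge false j).lab 1)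
      (TreeEdge.reduced G v w (genericMatrix V) L i j) := by
    intro i j
    rw [TreeEdge.reduced, Matrix.submatrix_apply, TreeIndex.reduced]
    split_ifs
    · exact .form (IsHomogeneousAt.mixedVec fun _ => hL _) (IsHomogeneousAt.mixedVec fun _ => hL _)
    · exact .zero _
  have h2 := (IsHomogeneous.det _ _ fun (i j : {i : G.TreeEdge v w // TreeEdge.rank i = 0}) =>
    h1 i.1 j.1).mul
    (IsHomogeneous.det _ _ fun (i j : {i : G.TreeEdge v w // TreeEdge.rank i = 2}) => h1 i.1 j.1)
  refine IsHomogeneous.isUnit (x := TreeEdge.cofactor G v w (genericMatrix V) L) h2 ?_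
  rw [TreeEdge.map_cofactor, h0, genericMatrix_map_evalOne, TreeEdge.cofactor_one_zero hG]
  exact one_ne_zero

end CovFrac

namespace MixedGraph

variable {V : Type*} {G : MixedGraph V}

theorem IsAcyclic.wellFounded [Finite V] (hG : G.IsAcyclic) : WellFounded G.dir := by
  have : Std.Irrefl (Relation.TransGen G.dir) := ⟨hG⟩
  exact Subrelation.wf (fun h => Relation.TransGen.single h)
    (Finite.wellFounded_of_trans_of_irrefl (Relation.TransGen G.dir))

end MixedGraph

/-! ### Recursive identification of the edge coefficients -/

namespace CovFrac

open CovPoly MixedGraph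

variable {V : Type*} [DecidableEq V]

theorem evalOne_form [Fintype V] {a b : V → CovFrac V} {y z : V}
    (ha : ∀ x, evalOne (a x) = if x = y then 1 else 0)
    (hb : ∀ x, evalOne (b x) = if x = z then 1 else 0) :
    evalOne (a ⬝ᵥ (genericMatrix V).mulVec b) = if y = z then 1 else 0 := by
  have hS : ∀ x x', evalOne (genericMatrix V x x') = (1 : Matrix V V ℝ) x x' := fun x x' => by
    rw [← genericMatrix_map_evalOne, Matrix.map_apply]
  simp only [dotProduct, Matrix.mulVec, map_sum, map_mul, ha, hb, hS]
  simp [Matrix.one_apply, eq_comm]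

theorem IsHomogeneousAt.evalOne_mixedVec {L : Matrix V V (CovFrac V)} {e : Prop} {y : V}
    (hL : e → IsHomogeneousAt L y) (x : V) :
    evalOne (MixedGraph.mixedVec L e y x) = if x = y then 1 else 0 := by
  by_cases h : e
  · rw [mixedVec_of_pos h]
    dsimp only
    rw [Matrix.sub_apply, map_sub, (hL h).evalOne_eq_zero, Matrix.one_apply, apply_ite evalOne,
      map_one, map_zero, sub_zero]
  · rw [mixedVec_of_neg h, Pi.single_apply, apply_ite evalOne, map_one, map_zero]

variable [Fintype V]

/-- A column of the matrix of edge coefficients is determined by the columns of the parents, by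
Cramer's rule. -/
theorem exists_column (G : MixedGraph V) (u : V) (L : Matrix V V (CovFrac V))
    (hL : ∀ y, G.dir y u → IsHomogeneousAt L y) :
    ∃ c : V → CovFrac V, (∀ x, ¬ G.dir x u → c x = 0) ∧
      (∀ x, IsHomogeneous (Pi.single u 1 - Pi.single x 1) (c x)) ∧ (∀ x, evalOne (c x) = 0) ∧
      ∀ y, G.dir y u → mixedVec L (y ∈ G.htr u) y ⬝ᵥ
        (genericMatrix V).mulVec (Pi.single u 1 - c) = 0 := by
  classical
  -- The equations for the parents of `u` form a square system A c = b whose unknowns are the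
  -- coefficients of the edges into `u`.
  let A : Matrix {y // G.dir y u} {y // G.dir y u} (CovFrac V) := fun i j =>
    mixedVec L (i.1 ∈ G.htr u) i.1 ⬝ᵥ (genericMatrix V).mulVec (mixedVec L False j.1)
  let b : {y // G.dir y u} → CovFrac V := fun i =>
    mixedVec L (i.1 ∈ G.htr u) i.1 ⬝ᵥ (genericMatrix V).mulVec (mixedVec L False u)
  have hA : ∀ i j, IsHomogeneous (Pi.single i.1 1 + Pi.single j.1 1) (A i j) := fun i j =>
    .form (IsHomogeneousAt.mixedVec fun _ => hL _ i.2) (IsHomogeneousAt.mixedVec False.elim)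
  have hb : ∀ i, IsHomogeneous (Pi.single i.1 1 + Pi.single u 1) (b i) := fun i =>
    .form (IsHomogeneousAt.mixedVec fun _ => hL _ i.2) (IsHomogeneousAt.mixedVec False.elim)
  have hA1 : A.map evalOne = 1 := by
    funext i j
    rw [Matrix.map_apply, Matrix.one_apply]
    refine (evalOne_form (IsHomogeneousAt.evalOne_mixedVec fun _ => hL _ i.2)
      (IsHomogeneousAt.evalOne_mixedVec False.elim)).trans ?_
    exact if_congr Subtype.ext_iff.symm rfl rfl
  have hb1 : ∀ i, evalOne (b i) = 0 := fun i => by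
    refine (evalOne_form (IsHomogeneousAt.evalOne_mixedVec fun _ => hL _ i.2)
      (IsHomogeneousAt.evalOne_mixedVec False.elim)).trans (if_neg ?_)
    intro h
    have h' := i.2
    rw [h] at h'
    exact G.dir_irrefl u h'
  have hdet := IsHomogeneous.det _ _ hA
  obtain ⟨z, hz, hz'⟩ := hdet.exists_inv (by
    rw [RingHom.map_det]
    change (A.map evalOne).det ≠ 0
    rw [hA1, Matrix.det_one]
    exact one_ne_zero)
  -- Replacing column j by b trades the degree e_j for e_u; after division by det A this leaves e_u
  -- - e_j.
  have hcr : ∀ j, IsHomogeneous (∑ i : {y // G.dir y u}, (Pi.single i.1 1 : V → ℤ) +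
      (∑ i : {y // G.dir y u}, Pi.single i.1 1 - Pi.single j.1 1 + Pi.single u 1))
      (A.cramer b j) := by
    intro j
    rw [Matrix.cramer_apply]
    have : (∑ i : {y // G.dir y u}, Pi.single i.1 1 - Pi.single j.1 1 + Pi.single u 1 : V → ℤ) =
        ∑ i : {y // G.dir y u}, if i = j then Pi.single u 1 else Pi.single i.1 1 := by
      rw [← Finset.add_sum_erase _ _ (Finset.mem_univ j),
        ← Finset.add_sum_erase _ (fun i => if i = j then _ else _) (Finset.mem_univ j), if_pos rfl,
        Finset.sum_congr rfl fun i hi => if_neg (Finset.ne_of_mem_erase hi)]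
      abel
    rw [this]
    refine .det _ _ fun i k => ?_
    rw [Matrix.updateCol_apply]
    split_ifs
    · exact hb i
    · exact hA i k
  have hcr1 : ∀ j, evalOne (A.cramer b j) = 0 := by
    intro j
    rw [Matrix.cramer_apply, RingHom.map_det]
    refine Matrix.det_eq_zero_of_column_eq_zero j fun i => ?_
    rw [RingHom.mapMatrix_apply, Matrix.map_apply, Matrix.updateCol_self, hb1]
  refine ⟨fun x => if h : G.dir x u then z * A.cramer b ⟨x, h⟩ else 0, fun x hx => dif_neg hx,
    fun x => ?_, fun x => ?_, fun y hy => ?_⟩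
  · dsimp only
    split_ifs with h
    · convert hz'.mul (hcr ⟨x, h⟩) using 1
      abel
    · exact .zero _
  · dsimp only
    split_ifs with h
    · rw [map_mul, hcr1, mul_zero]
    · exact map_zero _
  · have h1 := congrFun (Matrix.mulVec_cramer A b) ⟨y, hy⟩
    rw [Pi.smul_apply, smul_eq_mul] at h1
    have h2 : (Pi.single u 1 : V → CovFrac V) = mixedVec L False u :=
      (mixedVec_of_neg not_false).symm
    rw [Matrix.mulVec_sub, dotProduct_sub, sub_eq_zero, h2]
    change b ⟨y, hy⟩ = _
    calc b ⟨y, hy⟩ = z * (A.mulVec (A.cramer b) ⟨y, hy⟩) := by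
          rw [h1, ← mul_assoc, mul_comm z, hz, one_mul]
      _ = ∑ j : {y // G.dir y u}, A ⟨y, hy⟩ j * (z * A.cramer b j) := by
          rw [Matrix.mulVec, dotProduct, Finset.mul_sum]
          exact Finset.sum_congr rfl fun j _ => mul_left_comm _ _ _
      _ = ∑ x, mixedVec L (y ∈ G.htr u) y ⬝ᵥ (genericMatrix V).mulVec (mixedVec L False x) *
            (if h : G.dir x u then z * A.cramer b ⟨x, h⟩ else 0) := by
          refine Fintype.sum_of_injective Subtype.val Subtype.val_injective _ _ ?_ ?_
          · intro x hx
            rw [dif_neg, mul_zero]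
            exact fun h => hx ⟨⟨x, h⟩, rfl⟩
          · intro j
            rw [dif_pos j.2]
      _ = _ := by
          simp only [mixedVec_of_neg not_false, Matrix.mulVec_single_one]
          simp only [dotProduct, Matrix.mulVec, Finset.mul_sum, Finset.sum_mul]
          rw [Finset.sum_comm]
          refine Finset.sum_congr rfl fun x _ => Finset.sum_congr rfl fun x' _ => ?_
          rw [mul_assoc]
          rfl

/-- The directed edge coefficients of an acyclic graph are identified by the half-trek criterion:
they are `V`-homogeneous fractions. -/
theorem exists_isSolution (G : MixedGraph V) (hG : G.IsAcyclic) :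
    ∃ L, G.IsSolution (genericMatrix V) L ∧ ∀ y, IsHomogeneousAt L y := by
  classical
  -- The hypothesis on the parents' columns sits behind the existential, so that `step` is total and
  -- can drive a well-founded recursion; homogeneity is proved afterwards by induction.
  have hex : ∀ (u : V) (L : Matrix V V (CovFrac V)), ∃ c : V → CovFrac V,
      (∀ y, G.dir y u → IsHomogeneousAt L y) → (∀ x, ¬ G.dir x u → c x = 0) ∧
      (∀ x, IsHomogeneous (Pi.single u 1 - Pi.single x 1) (c x)) ∧ (∀ x, evalOne (c x) = 0) ∧
      ∀ y, G.dir y u → mixedVec L (y ∈ G.htr u) y ⬝ᵥ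
        (genericMatrix V).mulVec (Pi.single u 1 - c) = 0 := fun u L => by
    by_cases h : ∀ y, G.dir y u → IsHomogeneousAt L y
    · obtain ⟨c, hc⟩ := exists_column G u L h
      exact ⟨c, fun _ => hc⟩
    · exact ⟨0, fun h' => absurd h' h⟩
  choose step hstep using hex
  have hwf := hG.wellFounded
  let col : V → V → CovFrac V := hwf.fix fun u rec =>
    step u fun x y => if h : G.dir y u then rec y h x else 0
  let R (u : V) : Matrix V V (CovFrac V) := fun x y => if G.dir y u then col y x else 0
  have hcol : ∀ u, col u = step u (R u) := fun u => hwf.fix_eq _ u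
  let L : Matrix V V (CovFrac V) := fun x y => col y x
  have hR : ∀ u y, G.dir y u → ∀ x, R u x y = L x y := fun u y hy x => if_pos hy
  have hhom : ∀ u, IsHomogeneousAt L u := by
    intro u
    induction u using hwf.induction with
    | _ u ih =>
      obtain ⟨-, h1, h2, -⟩ := hstep u (R u) fun y hy =>
        ⟨fun x => by rw [hR u y hy]; exact (ih y hy).1 x,
          fun x => by rw [hR u y hy]; exact (ih y hy).2 x⟩
      rw [← hcol] at h1 h2
      exact ⟨h1, h2⟩
  have hall : ∀ u, _ := fun u => hstep u (R u) fun y hy =>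
        ⟨fun x => by rw [hR u y hy]; exact (hhom y).1 x,
          fun x => by rw [hR u y hy]; exact (hhom y).2 x⟩
  refine ⟨L, ⟨fun x y hxy => ?_, fun x y hxy => ?_⟩, hhom⟩
  · change col y x = 0
    rw [hcol]
    exact (hall y).1 x hxy
  · have h := (hall y).2.2.2 x hxy
    rw [← hcol] at h
    have h1 : mixedVec (R y) (x ∈ G.htr y) x = mixedVec L (x ∈ G.htr y) x := by
      by_cases he : x ∈ G.htr y
      · rw [mixedVec_of_pos he, mixedVec_of_pos he]
        funext z
        rw [Matrix.sub_apply, Matrix.sub_apply, hR y x hxy]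
      · rw [mixedVec_of_neg he, mixedVec_of_neg he]
    have h2 : mixedVec L True y = Pi.single y 1 - col y := by
      rw [mixedVec_of_pos trivial]
      funext z
      rw [Matrix.sub_apply, Pi.sub_apply, Matrix.one_apply, Pi.single_apply]
    rw [h2, ← h1]
    exact h

end CovFrac

/-! ### Half-trek equations, parametrization and the vanishing ideal -/

namespace MixedGraph

variable {V : Type*} {G : MixedGraph V}

theorem ne_and_not_adj_of_notMem_htr {y w : V} (hy : y ∉ G.htr w) :
    y ≠ w ∧ ¬ G.bi.Adj y w ∧ ¬ G.dir w y := by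
  refine ⟨?_, fun h => hy (Or.inr ⟨y, h.symm, .refl⟩), fun h => hy (Or.inl (.single h))⟩
  rintro rfl
  exact hy (Or.inl .refl)

/-- The ring of polynomials in the parameters of the model: the edge coefficients and the covariances
of the errors. -/
abbrev ParamPoly (V : Type*) : Type _ := MvPolynomial ((V × V) ⊕ Sym2 V) ℝ

open Classical in
/-- The generic matrix of edge coefficients. -/
noncomputable def paramL (G : MixedGraph V) : Matrix V V (ParamPoly V) :=
  fun x y => if G.dir x y then MvPolynomial.X (Sum.inl (x, y)) else 0

open Classical in
/-- The generic covariance matrix of the errors. -/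
noncomputable def paramW (G : MixedGraph V) : Matrix V V (ParamPoly V) :=
  fun x y => if x = y ∨ G.bi.Adj x y then MvPolynomial.X (Sum.inr s(x, y)) else 0

theorem isSymm_paramW (G : MixedGraph V) : G.paramW.IsSymm := by
  refine Matrix.IsSymm.ext fun x y => ?_
  have h : y = x ∨ G.bi.Adj y x ↔ x = y ∨ G.bi.Adj x y := by rw [eq_comm, G.bi.adj_comm]
  by_cases hxy : x = y ∨ G.bi.Adj x y
  · rw [paramW, paramW, if_pos hxy, if_pos (h.mpr hxy), Sym2.eq_swap]
  · rw [paramW, paramW, if_neg hxy, if_neg fun h' => hxy (h.mp h')]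

theorem paramL_support (x y : V) (h : ¬ G.dir x y) : G.paramL x y = 0 := if_neg h

theorem mem_vanishing_iff {A : Set (SymMatrix V)} {f : CovPoly V} :
    f ∈ CovPoly.vanishing A ↔ ∀ S ∈ A, CovPoly.evalAt S f = 0 := by
  simp [CovPoly.vanishing, CovPoly.evalAt, RingHom.mem_ker]

/-- This provides a box of admissible error covariances, large enough to detect nonzero polynomials.
-/
theorem posDef_of_diagonally_dominant [Fintype V] {W : Matrix V V ℝ} (hW : W.IsSymm)
    (hdiag : ∀ x, Fintype.card V + 1 ≤ W x x) (hoff : ∀ x y, x ≠ y → |W x y| ≤ 1) :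
    W.PosDef := by
  classical
  refine Matrix.PosDef.of_dotProduct_mulVec_pos ?_ fun x hx => ?_
  · rw [Matrix.IsHermitian, Matrix.conjTranspose_eq_transpose_of_trivial, hW.eq]
  have hpos : 0 < ∑ v, x v ^ 2 := by
    obtain ⟨v, hv⟩ := Function.ne_iff.mp hx
    exact Finset.sum_pos' (fun v _ => sq_nonneg _) ⟨v, Finset.mem_univ v, sq_pos_of_ne_zero hv⟩
  -- The subtracted terms sum to `card V` times the sum of squares, so the bound `card V + 1` leaves
  -- exactly one copy.
  have h1 : ∀ v w, (if v = w then (Fintype.card V + 1 : ℝ) * x v ^ 2 else 0) -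
      (x v ^ 2 + x w ^ 2) / 2 ≤ x v * (W v w * x w) := by
    intro v w
    split_ifs with h
    · subst h
      nlinarith [hdiag v, sq_nonneg (x v)]
    · have := abs_le.mp (hoff v w h)
      nlinarith [sq_nonneg (x v - x w), sq_nonneg (x v + x w)]
  have h2 := Finset.sum_le_sum fun v (_ : v ∈ Finset.univ) =>
    Finset.sum_le_sum fun w (_ : w ∈ Finset.univ) => h1 v w
  have h3 : ∑ v, ∑ w, ((if v = w then (Fintype.card V + 1 : ℝ) * x v ^ 2 else 0) -
      (x v ^ 2 + x w ^ 2) / 2) = ∑ v, x v ^ 2 := by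
    simp only [Finset.sum_sub_distrib, ← Finset.sum_div, Finset.sum_add_distrib,
      Finset.sum_ite_eq, Finset.mem_univ, if_true, Finset.sum_const, Finset.card_univ, nsmul_eq_mul,
      ← Finset.mul_sum]
    ring
  rw [h3] at h2
  simp only [dotProduct, Matrix.mulVec, Finset.mul_sum, star_trivial]
  exact hpos.trans_le h2

variable [Fintype V] [DecidableEq V]

section CommRing

variable {A : Type*} [CommRing A] {S L : Matrix V V A}

theorem mixedVec_true_dotProduct_mulVec (S L : Matrix V V A) (x y : V) :
    mixedVec L True x ⬝ᵥ S.mulVec (mixedVec L True y) =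
      ((1 - L).transpose * S * (1 - L)) x y := by
  rw [mixedVec_of_pos trivial, mixedVec_of_pos trivial, Matrix.mul_assoc]
  rfl

theorem mixedVec_true_dotProduct (L : Matrix V V A) (y : V) (c : V → A) :
    mixedVec L True y ⬝ᵥ c = mixedVec L False y ⬝ᵥ c - ∑ u, L u y * (mixedVec L False u ⬝ᵥ c) := by
  simp only [mixedVec_of_pos trivial, mixedVec_of_neg not_false, single_one_dotProduct]
  simp [dotProduct, Matrix.sub_apply, sub_mul, Finset.sum_sub_distrib, Matrix.one_apply]

/-- Along the nodes that are not half-trek reachable from `w`, the equations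
`((1 - L)ᵀ S (1 - L)) y w = 0` and `(S (1 - L)) y w = 0` are equivalent. -/
theorem form_eq_zero_of_notMem_htr (hG : G.IsAcyclic) (hL : ∀ x y, ¬ G.dir x y → L x y = 0) {w : V}
    {c : V → A}
    (h : ∀ y, y ∉ G.htr w → mixedVec L True y ⬝ᵥ c = 0 ∨ mixedVec L False y ⬝ᵥ c = 0) (y : V)
    (hy : y ∉ G.htr w) : mixedVec L True y ⬝ᵥ c = 0 ∧ mixedVec L False y ⬝ᵥ c = 0 := by
  induction y using hG.wellFounded.induction with
  | _ y ih =>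
    have h0 : ∑ u, L u y * (mixedVec L False u ⬝ᵥ c) = 0 := by
      refine Finset.sum_eq_zero fun u _ => ?_
      by_cases hu : G.dir u y
      -- If the parent `u` were half-trek reachable from `w`, extending the half-trek by `u → y`
      -- would reach `y`.
      · rw [(ih u hu fun hu' => hy ?_).2, mul_zero]
        rcases hu' with h1 | ⟨x, hx, h1⟩
        · exact Or.inl (h1.tail hu)
        · exact Or.inr ⟨x, hx, h1.tail hu⟩
      · rw [hL u y hu, zero_mul]
    have h1 := mixedVec_true_dotProduct L y c
    rw [h0, sub_zero] at h1
    rcases h y hy with h2 | h2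
    · exact ⟨h2, h1 ▸ h2⟩
    · exact ⟨h1.trans h2, h2⟩

/-- Bow-freeness makes the entry at an edge `x → y` one of the required zeros, which is the equation
if `x ∈ htr y`. Otherwise the equation has the form without `L` on the left, and
`form_eq_zero_of_notMem_htr` converts between the two. -/
theorem isSolution_of_support (hG : G.IsAcyclic) (hbow : G.IsBowFree)
    (hL : ∀ x y, ¬ G.dir x y → L x y = 0)
    (h : ∀ x y, x ≠ y → ¬ G.bi.Adj x y → ((1 - L).transpose * S * (1 - L)) x y = 0) :
    G.IsSolution S L := by
  refine ⟨hL, fun x y hxy => ?_⟩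
  have h' : ∀ x y, x ≠ y → ¬ G.bi.Adj x y →
      mixedVec L True x ⬝ᵥ S.mulVec (mixedVec L True y) = 0 := fun x y h1 h2 => by
    rw [mixedVec_true_dotProduct_mulVec, h x y h1 h2]
  by_cases hx : x ∈ G.htr y
  · rw [eq_true hx]
    refine h' x y ?_ (hbow x y hxy)
    rintro rfl
    exact G.dir_irrefl _ hxy
  · rw [eq_false hx]
    refine (form_eq_zero_of_notMem_htr hG hL (fun z hz => Or.inl ?_) x hx).2
    obtain ⟨h1, h2, -⟩ := ne_and_not_adj_of_notMem_htr hz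
    exact h' z y h1 h2

/-- The constraints cover only nonadjacent pairs; the zeros at directed edges come from the
half-trek equations. For `x ∉ htr y`, each `z ∉ htr y` is either a parent of `y`, with its own
equation, or not adjacent to `y`, so the conversion lemma applies again. -/
theorem IsSolution.form_eq_zero (hG : G.IsAcyclic) (hS : S.IsSymm) (hL : G.IsSolution S L)
    (h : ∀ x y, x ≠ y → ¬ G.bi.Adj x y → x ∉ G.pa y → y ∉ G.pa x →
      mixedVec L True x ⬝ᵥ S.mulVec (mixedVec L True y) = 0)
    (x y : V) (hxy : x ≠ y) (hbi : ¬ G.bi.Adj x y) :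
    mixedVec L True x ⬝ᵥ S.mulVec (mixedVec L True y) = 0 := by
  have key : ∀ x y, G.dir x y → mixedVec L True x ⬝ᵥ S.mulVec (mixedVec L True y) = 0 := by
    intro x y hdir
    by_cases hx : x ∈ G.htr y
    · have := hL.eq_zero x y hdir
      rwa [eq_true hx] at this
    · refine (form_eq_zero_of_notMem_htr hG hL.support (fun z hz => ?_) x hx).1
      obtain ⟨h1, h2, h3⟩ := ne_and_not_adj_of_notMem_htr hz
      by_cases hzy : G.dir z y
      · have := hL.eq_zero z y hzy
        rw [eq_false hz] at this
        exact Or.inr this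
      · exact Or.inl (h z y h1 h2 hzy h3)
  by_cases h1 : G.dir x y
  · exact key x y h1
  · by_cases h2 : G.dir y x
    · rw [dotProduct_mulVec_comm hS]
      exact key y x h2
    · exact h x y hxy hbi h1 h2

theorem det_one_sub (hG : G.IsAcyclic) (hL : ∀ x y, ¬ G.dir x y → L x y = 0) :
    (1 - L).det = 1 := by
  classical
  -- The number of strict ancestors increases along edges, so `1 - L` is unitriangular with respect
  -- to it.
  let r : V → ℕ := fun x => (Finset.univ.filter fun a => Relation.TransGen G.dir a x).card
  have hr : ∀ x y, G.dir x y → r x < r y := by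
    intro x y hxy
    refine Finset.card_lt_card (Finset.ssubset_iff_of_subset ?_ |>.mpr ⟨x, ?_, ?_⟩)
    · intro a ha
      simp only [Finset.mem_filter, Finset.mem_univ, true_and] at ha ⊢
      exact ha.tail hxy
    · simpa using Relation.TransGen.single hxy
    · simpa using hG x
  have h0 : ∀ x y, ¬ r x < r y → (1 - L) x y = (1 : Matrix V V A) x y := fun x y hxy => by
    rw [Matrix.sub_apply, hL x y fun h => hxy (hr x y h), sub_zero]
  have hb : (1 - L).BlockTriangular r := fun x y hxy => by
    rw [h0 x y hxy.not_gt, Matrix.one_apply_ne]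
    rintro rfl
    exact lt_irrefl _ hxy
  rw [hb.det]
  refine Finset.prod_eq_one fun a _ => ?_
  have : (1 - L).toSquareBlock r a = 1 := by
    funext i j
    rw [Matrix.toSquareBlock_def, Matrix.of_apply, h0 _ _ (i.2.trans j.2.symm).not_lt,
      Matrix.one_apply, Matrix.one_apply]
    exact if_congr Subtype.ext_iff.symm rfl rfl
  rw [this, Matrix.det_one]

theorem isUnit_one_sub (hG : G.IsAcyclic) (hL : ∀ x y, ¬ G.dir x y → L x y = 0) :
    IsUnit (1 - L) := by
  rw [Matrix.isUnit_iff_isUnit_det, det_one_sub hG hL]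
  exact isUnit_one

/-- The covariance matrix with given edge coefficients and given covariance matrix of the errors. -/
noncomputable def covariance (L W : Matrix V V A) : Matrix V V A :=
  ((1 - L)⁻¹).transpose * W * (1 - L)⁻¹

theorem isSymm_covariance (L : Matrix V V A) {W : Matrix V V A} (hW : W.IsSymm) :
    (covariance L W).IsSymm := by
  rw [Matrix.IsSymm, covariance, Matrix.transpose_mul, Matrix.transpose_mul,
    Matrix.transpose_transpose, hW.eq, Matrix.mul_assoc]

theorem eq_covariance_iff {L W S : Matrix V V A} (hL : IsUnit (1 - L)) :
    S = covariance L W ↔ (1 - L).transpose * S * (1 - L) = W := by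
  have h1 : (1 - L) * (1 - L)⁻¹ = 1 :=
    Matrix.mul_nonsing_inv _ ((Matrix.isUnit_iff_isUnit_det _).mp hL)
  have h2 : (1 - L)⁻¹ * (1 - L) = 1 :=
    Matrix.nonsing_inv_mul _ ((Matrix.isUnit_iff_isUnit_det _).mp hL)
  have h3 : ((1 - L)⁻¹).transpose * (1 - L).transpose = 1 := by
    rw [← Matrix.transpose_mul, h1, Matrix.transpose_one]
  have h4 : (1 - L).transpose * ((1 - L)⁻¹).transpose = 1 := by
    rw [← Matrix.transpose_mul, h2, Matrix.transpose_one]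
  constructor
  · rintro rfl
    rw [covariance, Matrix.mul_assoc, Matrix.mul_assoc, h2, Matrix.mul_one, ← Matrix.mul_assoc, h4,
      Matrix.one_mul]
  · rintro rfl
    rw [covariance, ← Matrix.mul_assoc, ← Matrix.mul_assoc, h3, Matrix.one_mul, Matrix.mul_assoc, h1,
      Matrix.mul_one]

theorem map_covariance {B : Type*} [CommRing B] (φ : A →+* B) {L W : Matrix V V A}
    (hL : IsUnit (1 - L)) : (covariance L W).map φ = covariance (L.map φ) (W.map φ) := by
  have h1 : (1 - L).map φ = 1 - L.map φ := by
    funext x y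
    simp only [Matrix.map_apply, Matrix.sub_apply, map_sub, Matrix.one_apply, apply_ite φ, map_one,
      map_zero]
  have h2 : IsUnit (1 - L.map φ) := by
    rw [← h1]
    exact hL.map φ.mapMatrix
  have h3 : (1 - L).transpose * covariance L W * (1 - L) = W := (eq_covariance_iff hL).mp rfl
  rw [eq_covariance_iff h2, ← h1, ← Matrix.transpose_map, ← Matrix.map_mul, ← Matrix.map_mul, h3]

end CommRing

/-- The parametrization of the model, as a homomorphism of polynomial rings. -/
noncomputable def param (G : MixedGraph V) : CovPoly V →+* ParamPoly V :=
  MvPolynomial.eval₂Hom MvPolynomial.C (Sym2.lift ⟨fun x y => covariance G.paramL G.paramW x y,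
    fun x y => ((isSymm_covariance _ (isSymm_paramW G)).apply x y).symm⟩)

theorem param_X (x y : V) : G.param (MvPolynomial.X s(x, y)) =
    covariance G.paramL G.paramW x y := by
  simp [param]

theorem map_param (hG : G.IsAcyclic) {B : Type*} [CommRing B] (φ : ParamPoly V →+* B)
    (θ : CovPoly V →+* B) (hC : ∀ r, θ (MvPolynomial.C r) = φ (MvPolynomial.C r))
    (hX : ∀ x y, θ (MvPolynomial.X s(x, y)) =
      covariance (G.paramL.map φ) (G.paramW.map φ) x y) (f : CovPoly V) :
    θ f = φ (G.param f) := by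
  have : θ = φ.comp G.param := by
    refine MvPolynomial.ringHom_ext (fun r => ?_) fun e => ?_
    · simp [param, hC]
    · induction e using Sym2.ind with
      | _ x y => rw [hX, RingHom.comp_apply, param_X,
          ← map_covariance φ (isUnit_one_sub hG paramL_support), Matrix.map_apply]
  rw [this, RingHom.comp_apply]

/-- A homomorphism from the ring of covariance polynomials at whose image matrix the equations of
the model can be solved factors through the parametrization. -/
theorem map_eq_of_param (hG : G.IsAcyclic) {B : Type*} [CommRing B] (θ : CovPoly V →+* B)
    {S L : Matrix V V B} (hS : S.IsSymm) (hθ : ∀ x y, θ (MvPolynomial.X s(x, y)) = S x y)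
    (hL : ∀ x y, ¬ G.dir x y → L x y = 0)
    (h : ∀ x y, x ≠ y → ¬ G.bi.Adj x y → ((1 - L).transpose * S * (1 - L)) x y = 0) :
    ∃ φ : ParamPoly V →+* B, ∀ f, θ f = φ (G.param f) := by
  set W := (1 - L).transpose * S * (1 - L) with hW
  have hWs : W.IsSymm := by
    rw [Matrix.IsSymm, hW, Matrix.transpose_mul, Matrix.transpose_mul, Matrix.transpose_transpose,
      hS.eq, Matrix.mul_assoc]
  let φ : ParamPoly V →+* B := MvPolynomial.eval₂Hom (θ.comp MvPolynomial.C)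
    (Sum.elim (fun p => L p.1 p.2) (Sym2.lift ⟨fun x y => W x y, fun x y => (hWs.apply x y).symm⟩))
  have hφL : G.paramL.map φ = L := by
    funext x y
    by_cases hxy : G.dir x y
    · simp [paramL, hxy, φ]
    · simp [paramL, hxy, hL x y hxy]
  have hφW : G.paramW.map φ = W := by
    funext x y
    by_cases hxy : x = y ∨ G.bi.Adj x y
    · simp [paramW, hxy, φ]
    · rw [Matrix.map_apply, paramW, if_neg hxy, map_zero]
      rw [not_or] at hxy
      exact (h x y hxy.1 hxy.2).symm
  refine ⟨φ, map_param hG φ θ (fun r => by simp [φ]) fun x y => ?_⟩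
  rw [hφL, hφW, hθ, ← (eq_covariance_iff (isUnit_one_sub hG hL)).mpr hW.symm]

open CovPoly

/-- The model contains the image of a product of infinite sets of parameters, on which only the zero
polynomial vanishes; conversely, evaluation at a point of the model factors through the
parametrization. -/
theorem mem_vanishing_model_iff (hG : G.IsAcyclic) {f : CovPoly V} :
    f ∈ vanishing G.model ↔ G.param f = 0 := by
  classical
  rw [mem_vanishing_iff]
  constructor
  · intro h
    let s : (V × V) ⊕ Sym2 V → Set ℝ :=
      Sum.elim (fun _ => Set.univ) (Sym2.lift ⟨fun x y =>
        {r | (x = y → Fintype.card V + 1 ≤ r) ∧ (x ≠ y → |r| ≤ 1)}, fun x y => by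
          simp only [eq_comm, ne_eq]⟩)
    refine MvPolynomial.funext_set s ?_ fun a ha => ?_
    · rintro (p | e)
      · exact Set.infinite_univ
      · induction e using Sym2.ind with
        | _ x y =>
          by_cases hxy : x = y
          · refine (Set.Ici_infinite (Fintype.card V + 1 : ℝ)).mono fun r hr => ?_
            exact ⟨fun _ => hr, fun h => absurd hxy h⟩
          · refine (Set.Icc_infinite (show (-1 : ℝ) < 1 by norm_num)).mono fun r hr => ?_
            exact ⟨fun h => absurd h hxy, fun _ => abs_le.mpr hr⟩
    · have ha' : ∀ x y, (x = y → Fintype.card V + 1 ≤ a (Sum.inr s(x, y))) ∧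
          (x ≠ y → |a (Sum.inr s(x, y))| ≤ 1) := fun x y => ha (Sum.inr s(x, y)) (Set.mem_univ _)
      let φ := MvPolynomial.eval a
      have hL : ∀ x y, ¬ G.dir x y → G.paramL.map φ x y = 0 := fun x y hxy => by
        rw [Matrix.map_apply, paramL_support x y hxy, map_zero]
      have hWs : (G.paramW.map φ).IsSymm := (isSymm_paramW G).map φ
      have hW : ∀ x y, G.paramW.map φ x y =
          if x = y ∨ G.bi.Adj x y then a (Sum.inr s(x, y)) else 0 := fun x y => by
        by_cases hxy : x = y ∨ G.bi.Adj x y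
        · rw [Matrix.map_apply, paramW, if_pos hxy, if_pos hxy, MvPolynomial.eval_X]
        · rw [Matrix.map_apply, paramW, if_neg hxy, if_neg hxy, map_zero]
      have hS : (⟨covariance (G.paramL.map φ) (G.paramW.map φ), isSymm_covariance _ hWs⟩ :
          SymMatrix V) ∈ G.model := by
        refine ⟨_, _, hL, isUnit_one_sub hG hL, posDef_of_diagonally_dominant hWs ?_ ?_, ?_, rfl⟩
        · intro x
          rw [hW, if_pos (Or.inl rfl)]
          exact (ha' x x).1 rfl
        · intro x y hxy
          rw [hW]
          split_ifs
          · exact (ha' x y).2 hxy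
          · simp
        · intro x y hxy hbi
          rw [hW, if_neg (not_or.mpr ⟨hxy, hbi⟩)]
      rw [map_zero, ← h _ hS]
      exact (map_param hG φ (MvPolynomial.eval _) (by simp [φ])
        (fun x y => by simp [SymMatrix.entry]) f).symm
  · intro h S hS
    obtain ⟨L, W, hL, hu, -, hW, hS'⟩ := hS
    obtain ⟨φ, hφ⟩ := map_eq_of_param hG (MvPolynomial.eval S.entry) S.2
      (fun x y => by simp [SymMatrix.entry]) hL (by
        rw [(eq_covariance_iff hu).mp hS']
        exact hW)
    rw [evalAt, hφ, h, map_zero]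

end MixedGraph

/-! ### Comparison of the ideals and the primary decomposition -/

namespace MixedGraph

open CovPoly

variable {V : Type*} {G : MixedGraph V} [Fintype V] [DecidableEq V]

theorem map_form {A B : Type*} [CommRing A] [CommRing B] (φ : A →+* B) (S L : Matrix V V A)
    (e e' : Prop) (x y : V) : φ (mixedVec L e x ⬝ᵥ S.mulVec (mixedVec L e' y)) =
      mixedVec (L.map φ) e x ⬝ᵥ (S.map φ).mulVec (mixedVec (L.map φ) e' y) := by
  simp only [dotProduct, Matrix.mulVec, map_sum, map_mul, mixedVec_map, Matrix.map_apply]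

theorem IsSolution.map {A B : Type*} [CommRing A] [CommRing B] (φ : A →+* B) {S L : Matrix V V A}
    (h : G.IsSolution S L) : G.IsSolution (S.map φ) (L.map φ) :=
  ⟨fun x y hxy => by rw [Matrix.map_apply, h.support x y hxy, map_zero],
    fun x y hxy => by rw [← map_form, h.eq_zero x y hxy, map_zero]⟩

/-- The graphical constraints hold on the model. -/
theorem htcIdeal_le_vanishing (hG : G.IsAcyclic) (hbow : G.IsBowFree) :
    G.htcIdeal G.pa ≤ vanishing G.model := by
  classical
  refine Ideal.span_le.mpr ?_
  rintro f ⟨v, w, hne, hbi, hvw, hwv, hf⟩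
  refine mem_vanishing_iff.mpr ?_
  rintro S ⟨L, W, hL, hu, -, hW, hS⟩
  have := TreeNode.finite (v := v) (w := w) hG
  let _ := Fintype.ofFinite (G.TreeEdge v w)
  have h : ∀ x y, x ≠ y → ¬ G.bi.Adj x y → ((1 - L).transpose * S.1 * (1 - L)) x y = 0 := by
    rw [(eq_covariance_iff hu).mp hS]
    exact hW
  obtain ⟨ε, hε⟩ := TreeEdge.map_of_represents_htcConstraint hG hvw hwv hf S.2
    (isSolution_of_support hG hbow hL h) (MvPolynomial.eval S.entry)
    (fun x y => by simp [SymMatrix.entry])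
  rw [evalAt, hε, mixedVec_true_dotProduct_mulVec, h v w hne hbi, mul_zero, mul_zero]

/-- Up to denominators that are `V`-homogeneous and do not vanish at the identity matrix, the
graphical constraints generate the vanishing ideal of the model. -/
theorem exists_mul_mem_htcIdeal (hG : G.IsAcyclic) {f : CovPoly V} (hf : f ∈ vanishing G.model) :
    ∃ s ∈ unitSubmonoid V, s * f ∈ G.htcIdeal G.pa := by
  classical
  obtain ⟨L, hL, hhom⟩ := CovFrac.exists_isSolution G hG
  let J := (G.htcIdeal G.pa).map (algebraMap (CovPoly V) (CovFrac V))
  let π := Ideal.Quotient.mk J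
  have hS := CovFrac.isSymm_genericMatrix (V := V)
  -- Each generator is a unit times the corresponding entry, so the entry itself lies in the
  -- extended ideal.
  have hform : ∀ x y, x ≠ y → ¬ G.bi.Adj x y → x ∉ G.pa y → y ∉ G.pa x →
      mixedVec (L.map π) True x ⬝ᵥ
        ((CovFrac.genericMatrix V).map π).mulVec (mixedVec (L.map π) True y) = 0 := by
    intro x y hne hbi hxy hyx
    have := TreeNode.finite (v := x) (w := y) hG
    let _ := Fintype.ofFinite (G.TreeEdge x y)
    obtain ⟨g, hg⟩ := TreeEdge.exists_represents_htcConstraint hG hxy hyx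
    obtain ⟨ε, hε⟩ := TreeEdge.map_of_represents_htcConstraint hG hxy hyx hg hS hL
      (algebraMap (CovPoly V) (CovFrac V)) fun _ _ => rfl
    have hgJ : algebraMap (CovPoly V) (CovFrac V) g ∈ J :=
      Ideal.mem_map_of_mem _ (Ideal.subset_span ⟨x, y, hne, hbi, hxy, hyx, hg⟩)
    have hε' : IsUnit ((ε : ℤ) : CovFrac V) := ε.isUnit.map (Int.castRingHom (CovFrac V))
    rw [hε, Ideal.unit_mul_mem_iff_mem _ hε', Ideal.unit_mul_mem_iff_mem _
      (CovFrac.isUnit_cofactor hG hhom x y)] at hgJ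
    rw [← map_form]
    exact Ideal.Quotient.eq_zero_iff_mem.mpr hgJ
  obtain ⟨φ, hφ⟩ := map_eq_of_param hG (π.comp (algebraMap (CovPoly V) (CovFrac V)))
    (hS.map π) (fun _ _ => rfl) (hL.map π).support fun x y hxy hbi => by
      rw [← mixedVec_true_dotProduct_mulVec]
      exact (hL.map π).form_eq_zero hG (hS.map π) hform x y hxy hbi
  have h := hφ f
  rw [(mem_vanishing_model_iff hG).mp hf, map_zero, RingHom.comp_apply,
    Ideal.Quotient.eq_zero_iff_mem] at h
  -- Here f is known to lie in the extended ideal. Clearing denominators costs `s`, and returning to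
  -- an identity of polynomials costs `t`.
  obtain ⟨⟨⟨a, ha⟩, s⟩, has⟩ := (IsLocalization.mem_map_algebraMap_iff (unitSubmonoid V) _).mp h
  rw [← map_mul] at has
  obtain ⟨t, ht⟩ := (IsLocalization.eq_iff_exists (unitSubmonoid V) (CovFrac V)).mp has
  refine ⟨t * s, mul_mem t.2 s.2, ?_⟩
  rw [mul_assoc, mul_comm (s : CovPoly V), ht]
  exact Ideal.mul_mem_left _ _ ha

theorem isPrime_vanishing_model (hG : G.IsAcyclic) : (vanishing G.model).IsPrime := by
  have : vanishing G.model = RingHom.ker G.param := by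
    ext f
    rw [mem_vanishing_model_iff hG, RingHom.mem_ker]
  rw [this]
  exact RingHom.ker_isPrime _

theorem identity_mem_model (G : MixedGraph V) : SymMatrix.identity V ∈ G.model :=
  ⟨0, 1, fun _ _ _ => rfl, by simp, .one, fun _ _ h _ => Matrix.one_apply_ne h, by
    simp [SymMatrix.identity]⟩

/-- In a minimal primary decomposition of the ideal of graphical constraints, the vanishing ideal of
the model is a component, and all others contain a `V`-homogeneous polynomial that does not vanish
at the identity matrix. -/
theorem decomposition_htcIdeal (hG : G.IsAcyclic) (hbow : G.IsBowFree)
    {t : Finset (Ideal (CovPoly V))}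
    (ht : Submodule.IsMinimalPrimaryDecomposition (G.htcIdeal G.pa) t) :
    vanishing G.model ∈ t ∧
      ∀ Q ∈ t, Q ≠ vanishing G.model → ∃ s ∈ Q, s ∈ unitSubmonoid V := by
  classical
  have hle : ∀ Q ∈ t, (¬ ∃ s ∈ Q, s ∈ unitSubmonoid V) → vanishing G.model ≤ Q := by
    intro Q hQ hdisj f hf
    obtain ⟨s, hs, hsf⟩ := exists_mul_mem_htcIdeal hG hf
    rw [← ht.inf_eq] at hsf
    have hsQ : f * s ∈ Q := by
      rw [mul_comm]
      exact (Finset.inf_le hQ : t.inf id ≤ Q) hsf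
    -- Powers of `s` stay in the multiplicative set, so a component that misses it must contain `f`.
    rcases (Ideal.isPrimary_iff.mp (ht.primary hQ)).2 hsQ with h | ⟨n, hn⟩
    · exact h
    · exact absurd ⟨s ^ n, hn, pow_mem hs n⟩ hdisj
  have hJ : t.inf id ≤ vanishing G.model := by
    rw [ht.inf_eq]
    exact htcIdeal_le_vanishing hG hbow
  obtain ⟨Q₀, hQ₀, hQ₀'⟩ := (isPrime_vanishing_model hG).inf_le'.mp hJ
  have hd : ¬ ∃ s ∈ Q₀, s ∈ unitSubmonoid V := by
    rintro ⟨s, hs, hs'⟩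
    exact hs'.2 (mem_vanishing_iff.mp (hQ₀' hs) _ G.identity_mem_model)
  obtain rfl : Q₀ = vanishing G.model := le_antisymm hQ₀' (hle _ hQ₀ hd)
  refine ⟨hQ₀, fun Q hQ hne => ?_⟩
  by_contra h
  -- Such a `Q` would contain the component I_G and be redundant.
  refine ht.minimal hQ (le_trans (Finset.inf_le ?_) (hle Q hQ h))
  exact Finset.mem_erase.mpr ⟨hne.symm, hQ₀⟩

end MixedGraph

theorem mainTheorem3 {V : Type*} [Fintype V] [DecidableEq V] (G : MixedGraph V)
    (hbow : G.IsBowFree) (hacyc : G.IsAcyclic) :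
    G.IsIPrimary (G.htcIdeal G.pa) ∧
    ∀ t : Finset (Ideal (CovPoly V)),
      Submodule.IsMinimalPrimaryDecomposition (G.htcIdeal G.pa) t →
      (∃! Q, Q ∈ t ∧ ¬ G.IsSpurious Q) ∧
      ∀ Q ∈ t, G.IsSpurious Q →
        ∀ S : SymMatrix V, S.1.PosDef → S.1.IsDiag → S ∉ CovPoly.variety Q := by
  have hns : ¬ G.IsSpurious (CovPoly.vanishing G.model) := not_not.mpr rfl
  have key : ∀ t : Finset (Ideal (CovPoly V)),
      Submodule.IsMinimalPrimaryDecomposition (G.htcIdeal G.pa) t → ∀ Q ∈ t, G.IsSpurious Q →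
      ∃ s ∈ Q, s ∈ CovPoly.unitSubmonoid V := fun t ht Q hQ hs =>
    (MixedGraph.decomposition_htcIdeal hacyc hbow ht).2 Q hQ fun h => hns (h ▸ hs)
  refine ⟨fun t ht Q hQ hs => ?_, fun t ht => ⟨?_, fun Q hQ hs S hS hS' hSQ => ?_⟩⟩
  · obtain ⟨f, hf, ⟨d, hd⟩, h1⟩ := key t ht Q hQ hs
    exact ⟨f, hf, CovPoly.isVHomogeneous_of_intWeight hd,
      CovPoly.hasDiagonalMonomial_of_evalOne_ne_zero h1⟩
  · obtain ⟨h1, h2⟩ := MixedGraph.decomposition_htcIdeal hacyc hbow ht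
    refine ⟨_, ⟨h1, hns⟩, fun Q hQ => ?_⟩
    by_contra hne
    obtain ⟨s, hs, hs'⟩ := h2 Q hQ.1 hne
    -- A second non-spurious component would have the identity in its variety, yet contain a
    -- polynomial that is nonzero there.
    have hid : SymMatrix.identity V ∈ CovPoly.variety Q := by
      rw [not_not.mp hQ.2]
      exact fun f hf => MixedGraph.mem_vanishing_iff.mp hf _ G.identity_mem_model
    exact hs'.2 (hid s hs)
  · obtain ⟨f, hf, hf'⟩ := key t ht Q hQ hs
    exact CovPoly.evalAt_ne_zero_of_mem_unitSubmonoid hf' hS hS' (hSQ f hf)
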